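/- Let $n\ge 2$, let $\Omega\subset\mathbb R^n$ be a bounded Lipschitz domain, $T>0$, $\nu>0$, and $Q_T:=\Omega\times(0,T)$. Let $b\in L_2(Q_T;\mathbb R^n)$, $u_0\in L_2(\Omega)$, $f\in L_1(Q_T)$, and assume that $\operatorname{div} b\le 0$ in $\mathcal D'(Q_T)$, i.e. $\int_{Q_T} b\cdot\nabla\eta\,dx\,dt\ge 0$ for every $\eta\in C_0^\infty(Q_T)$ with $\eta\ge 0$, where $\nabla$ is the gradient in $x$. Let $\overset{\circ}{W}{}^1_2(\Omega)$ denote the closure of $C_0^\infty(\Omega)$ in $W^1_2(\Omega)$, and let $u:Q_T\to\mathbb R$ be a weak solution of $$\partial_t u-\nu\Delta u+b\cdot\nabla u=f\ \text{ in } Q_T,\qquad u|_{\partial\Omega\times(0,T)}=0,\qquad u|_{t=0}=u_0,$$ that is, $u\in L_\infty(0,T;L_2(\Omega))\cap L_2(0,T;\overset{\circ}{W}{}^1_2(\Omega))$ and $$\int_{Q_T}\big(-u\,\partial_t\eta+\nu\,\nabla u\cdot\nabla\eta\big)\,dx\,dt+\int_{Q_T} (b\cdot\nabla u)\,\eta\,dx\,dt=\int_\Omega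 u_0(x)\,\eta(x,0)\,dx+\int_{Q_T} f\,\eta\,dx\,dt$$ for every $\eta\in C_0^\infty(\Omega\times[0,T))$. Then $u\in C([0,T];L_1(\Omega))$; that is, there is a continuous function $[0,T]\to L_1(\Omega)$, again denoted by $u$, which coincides with the given $u(\cdot,t)$ for a.e. $t\in(0,T)$, and it satisfies $u(\cdot,0)=u_0$. Moreover, for all $0\le t_1\le t_2\le T$, $$\|u(\cdot,t_2)\|_{L_1(\Omega)}\le\|u(\cdot,t_1)\|_{L_1(\Omega)}+\int_{t_1}^{t_2}\int_\Omega|f(x,t)|\,dx\,dt .$$ In particular, if $f=0$ a.e. in $Q_T$, then $t\mapsto\|u(\cdot,t)\|_{L_1(\Omega)}$ is non-increasing on $[0,T]$. -/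

import Mathlib

open MeasureTheory Set Filter Topology
open scoped ContDiff ENNReal NNReal

noncomputable section

namespace ParabolicDrift

/-- The Euclidean space `ℝⁿ`. -/
abbrev E (n : ℕ) : Type := EuclideanSpace ℝ (Fin n)

/-- Bounded Lipschitz domain: a bounded, nonempty, connected open set which, near each boundary
point and in a suitable orthonormal frame with "vertical" unit vector `e`, is the strict
supergraph of a Lipschitz function `γ` of the "horizontal" component of `x`. -/
structure IsBoundedLipschitzDomain {n : ℕ} (Ω : Set (E n)) : Prop where
  isOpen : IsOpen Ω
  isConnected : IsConnected Ω
  isBounded : Bornology.IsBounded Ω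
  lipschitz_boundary : ∀ x₀ ∈ frontier Ω, ∃ (e : E n) (r : ℝ) (K : ℝ≥0) (γ : E n → ℝ),
    ‖e‖ = 1 ∧ 0 < r ∧ LipschitzWith K γ ∧
      ∀ x ∈ Metric.ball x₀ r, (x ∈ Ω ↔ γ (x - inner ℝ x e • e) < inner ℝ x e)

/-- The space-time cylinder `Q_T = Ω × (0,T)`. -/
def cylinder {n : ℕ} (Ω : Set (E n)) (T : ℝ) : Set (E n × ℝ) := Ω ×ˢ Ioo 0 T

/-- `φ ∈ C_0^∞(U)`: smooth with compact support contained in `U`. -/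
structure IsTestFunction {V : Type*} [NormedAddCommGroup V] [NormedSpace ℝ V]
    (U : Set V) (φ : V → ℝ) : Prop where
  contDiff : ContDiff ℝ ∞ φ
  hasCompactSupport : HasCompactSupport φ
  tsupport_subset : tsupport φ ⊆ U

/-- Spatial gradient `∇η(x,t)` of a function of `(x,t)`. -/
def gradX {n : ℕ} (η : E n × ℝ → ℝ) (z : E n × ℝ) : E n :=
  gradient (fun y => η (y, z.2)) z.1

/-- Time derivative `∂_t η(x,t)` of a function of `(x,t)`. -/
def derivT {n : ℕ} (η : E n × ℝ → ℝ) (z : E n × ℝ) : ℝ :=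
  deriv (fun s => η (z.1, s)) z.2

/-- `g` is the weak gradient of `v` in `Ω`. -/
def HasWeakGradient {n : ℕ} (Ω : Set (E n)) (v : E n → ℝ) (g : E n → E n) : Prop :=
  ∀ φ : E n → ℝ, IsTestFunction Ω φ →
    ∀ i : Fin n, ∫ x in Ω, v x * gradient φ x i = -∫ x in Ω, g x i * φ x

/-- `v ∈ W^1_2(Ω)` with weak gradient `g`. -/
structure MemW12 {n : ℕ} (Ω : Set (E n)) (v : E n → ℝ) (g : E n → E n) : Prop where
  memLp : MemLp v 2 (volume.restrict Ω)
  memLp_grad : MemLp g 2 (volume.restrict Ω)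
  weakGradient : HasWeakGradient Ω v g

/-- `v ∈ W̊^1_2(Ω)` with weak gradient `g`: `v` belongs to the closure of `C_0^∞(Ω)` in the
norm of `W^1_2(Ω)`. -/
structure MemW12Zero {n : ℕ} (Ω : Set (E n)) (v : E n → ℝ) (g : E n → E n) : Prop where
  memW12 : MemW12 Ω v g
  mem_closure : ∃ φ : ℕ → E n → ℝ, (∀ k, IsTestFunction Ω (φ k)) ∧
    Tendsto (fun k => eLpNorm (fun x => φ k x - v x) 2 (volume.restrict Ω)) atTop (𝓝 0) ∧
    Tendsto (fun k => eLpNorm (fun x => gradient (φ k) x - g x) 2 (volume.restrict Ω))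
      atTop (𝓝 0)

/-- The energy class `u ∈ L_∞(0,T; L_2(Ω)) ∩ L_2(0,T; W̊^1_2(Ω))`, where `G = ∇u` is the
spatial gradient of `u`. -/
structure MemEnergyClass {n : ℕ} (Ω : Set (E n)) (T : ℝ) (u : E n × ℝ → ℝ)
    (G : E n × ℝ → E n) : Prop where
  memLp : MemLp u 2 (volume.restrict (cylinder Ω T))
  memLp_grad : MemLp G 2 (volume.restrict (cylinder Ω T))
  essBounded : ∃ M : ℝ≥0, ∀ᵐ t ∂(volume.restrict (Ioo (0 : ℝ) T)),
    eLpNorm (fun x => u (x, t)) 2 (volume.restrict Ω) ≤ M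
  memW12Zero : ∀ᵐ t ∂(volume.restrict (Ioo (0 : ℝ) T)),
    MemW12Zero Ω (fun x => u (x, t)) (fun x => G (x, t))

/-- `div b ≤ 0` in the sense of distributions on `Q_T`. -/
def DivNonpos {n : ℕ} (Ω : Set (E n)) (T : ℝ) (b : E n × ℝ → E n) : Prop :=
  ∀ η : E n × ℝ → ℝ, IsTestFunction (cylinder Ω T) η → (∀ z, 0 ≤ η z) →
    0 ≤ ∫ z in cylinder Ω T, inner ℝ (b z) (gradX η z)

/-- Weak solution of `∂_t u - ν Δu + b·∇u = f` in `Q_T`, `u = 0` on `∂Ω × (0,T)`,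
`u = u₀` at `t = 0`. The test functions `η ∈ C_0^∞(Ω × [0,T))` are the restrictions to `t ≥ 0`
of functions in `C_0^∞(Ω × (-∞,T))`. -/
def IsWeakSolution {n : ℕ} (Ω : Set (E n)) (T ν : ℝ) (b : E n × ℝ → E n) (u₀ : E n → ℝ)
    (f : E n × ℝ → ℝ) (u : E n × ℝ → ℝ) : Prop :=
  ∃ G : E n × ℝ → E n, MemEnergyClass Ω T u G ∧
    ∀ η : E n × ℝ → ℝ, IsTestFunction (Ω ×ˢ Iio T) η →
      (∫ z in cylinder Ω T, (-(u z * derivT η z) + ν * inner ℝ (G z) (gradX η z))) +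
          (∫ z in cylinder Ω T, inner ℝ (b z) (G z) * η z) =
        (∫ x in Ω, u₀ x * η (x, 0)) + ∫ z in cylinder Ω T, f z * η z

end ParabolicDrift

end

noncomputable section

namespace ParabolicDrift

set_option linter.unusedSectionVars false

/-! ### Mollification in time: measurability, integrability, linearity, Fubini. -/

section TimeMollification

variable {X V : Type*} [MeasurableSpace X] [NormedAddCommGroup V] [NormedSpace ℝ V]

/-! Since b and ∇u lie in L_2(Q_T), the function g = f - b·∇u lies in L_1(Q_T), and u solves the
heat equation with source g (`exists_isHeatSolution`). Existence of a continuous L_1-valued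
representative uses only this; the sign of div b enters only in the norm estimate.

Let ρ be a smooth kernel supported in (0,∞), possibly signed. Convolving the equation in time with ρ
gives, at every fixed time t ≤ T, a stationary weak equation whose residual ∂_t u_ρ - ρ(t)u₀ - g_ρ
is integrable. The convolution u_ρ(·,t) still belongs to the closure of the test functions
(`isTestLimit_timeMollify`), so the equation may be tested with S'(u_ρ), where S is a smooth convex
approximation of the absolute value. Convexity makes the diffusion term nonnegative. Integrating in
time and letting S(r) → |r| yields ‖u_ρ(t)‖₁ ≤ ‖ρ‖₁‖u₀‖₁ + ‖g_ρ‖_{L_1(Q_T)}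
(`integral_abs_timeMollify_le`).

Take for ρ the difference of two approximate identities. The g-term is then small, but the u₀-term
is not. It is made small by first subtracting a test function φ that is L_1-close to u₀: u - φ
solves a heat equation with source g + νΔφ and initial value u₀ - φ. Hence the mollifications of u -
φ are Cauchy uniformly in t up to an arbitrarily small error (`exists_uniform_cauchy`). At each t >
0, late mollifications leave φ unchanged, so those of u converge in L_1; the limit, completed by u₀
at t = 0, is continuous on [0,T] (`exists_continuousOn_limit`).

For 0 < t₁ ≤ t₂ the inequality for S passes to the limit with source term ∫ g S'(u). Its drift part
is -∫ b·∇(S(u)), which is nonpositive because S(u) ≥ 0 vanishes on the boundary and div b ≤ 0 on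
almost every time slice (`DivNonpos.ae_slice`, `integral_drift_nonneg`). What remains is at most
∫|f|. Letting S(r) → |r| gives the estimate for t₁ > 0, and continuity extends it to t₁ = 0. -/

/-- The measure of the time interval `(0,T)`. -/
abbrev timeMeasure (T : ℝ) : Measure ℝ := volume.restrict (Ioo 0 T)

/-- Convolution in time with the kernel `ρ` of the extension by zero of `F` from `(0,T)`. -/
def timeMollify (T : ℝ) (ρ : ℝ → ℝ) (F : X × ℝ → V) (x : X) (t : ℝ) : V :=
  ∫ s, ρ (t - s) • F (x, s) ∂(timeMeasure T)

theorem stronglyMeasurable_timeMollify (T : ℝ) {ρ : ℝ → ℝ} (hρ : Continuous ρ)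
    {F : X × ℝ → V} (hF : StronglyMeasurable F) :
    StronglyMeasurable (fun z : X × ℝ => timeMollify T ρ F z.1 z.2) := by
  unfold timeMollify
  have h : StronglyMeasurable (fun p : (X × ℝ) × ℝ => ρ (p.1.2 - p.2) • F (p.1.1, p.2)) := by
    apply StronglyMeasurable.smul
    · exact hρ.stronglyMeasurable.comp_measurable (by fun_prop)
    · exact hF.comp_measurable (by fun_prop)
  exact h.integral_prod_right'

theorem stronglyMeasurable_timeMollify_slice (T : ℝ) {ρ : ℝ → ℝ} (hρ : Continuous ρ)
    {F : X × ℝ → V} (hF : StronglyMeasurable F) (t : ℝ) :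
    StronglyMeasurable (fun x => timeMollify T ρ F x t) :=
  (stronglyMeasurable_timeMollify T hρ hF).comp_measurable
    (g := fun x : X => (x, t)) (by fun_prop)

theorem enorm_timeMollify_le (T : ℝ) (ρ : ℝ → ℝ) (F : X × ℝ → V) (x : X) (t : ℝ) :
    ‖timeMollify T ρ F x t‖ₑ ≤ ∫⁻ s, ‖ρ (t - s)‖ₑ * ‖F (x, s)‖ₑ ∂(timeMeasure T) := by
  refine (enorm_integral_le_lintegral_enorm _).trans_eq ?_
  simp [enorm_smul]

theorem exists_bound_of_hasCompactSupport {ρ : ℝ → ℝ} (hρ : Continuous ρ)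
    (hc : HasCompactSupport ρ) : ∃ C : ℝ≥0, ∀ r, ‖ρ r‖ ≤ C := by
  obtain ⟨C, hC⟩ := hρ.bounded_above_of_compact_support hc
  exact ⟨C.toNNReal, fun r => (hC r).trans (Real.le_coe_toNNReal C)⟩

variable {μ : Measure X} [SFinite μ]

/-- Bounding the kernel by its supremum gives an estimate at every time t, not merely almost every
t; this is what allows work on a fixed time slice. -/
theorem lintegral_enorm_timeMollify_slice_le (T : ℝ) {ρ : ℝ → ℝ} {C : ℝ≥0}
    (hC : ∀ r, ‖ρ r‖ ≤ C) {F : X × ℝ → V} (hF : StronglyMeasurable F) (t : ℝ) :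
    ∫⁻ x, ‖timeMollify T ρ F x t‖ₑ ∂μ ≤ C * ∫⁻ z, ‖F z‖ₑ ∂(μ.prod (timeMeasure T)) := by
  rw [lintegral_prod _ hF.enorm.aemeasurable,
    ← lintegral_const_mul _ hF.enorm.lintegral_prod_right']
  refine lintegral_mono fun x => (enorm_timeMollify_le T ρ F x t).trans ?_
  have hm : Measurable (fun s => ‖F (x, s)‖ₑ) :=
    hF.enorm.comp (f := fun s : ℝ => (x, s)) (by fun_prop)
  rw [← lintegral_const_mul _ hm]
  refine lintegral_mono fun s => ?_
  gcongr
  rw [← ofReal_norm, ← ENNReal.ofReal_coe_nnreal]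
  exact ENNReal.ofReal_le_ofReal (hC _)

theorem integrable_timeMollify_slice (T : ℝ) {ρ : ℝ → ℝ} (hρ : Continuous ρ)
    (hc : HasCompactSupport ρ) {F : X × ℝ → V} (hF : StronglyMeasurable F)
    (hFi : Integrable F (μ.prod (timeMeasure T))) (t : ℝ) :
    Integrable (fun x => timeMollify T ρ F x t) μ := by
  obtain ⟨C, hC⟩ := exists_bound_of_hasCompactSupport hρ hc
  refine ⟨(stronglyMeasurable_timeMollify_slice T hρ hF t).aestronglyMeasurable, ?_⟩
  exact (lintegral_enorm_timeMollify_slice_le T hC hF t).trans_lt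
    (ENNReal.mul_lt_top ENNReal.coe_lt_top hFi.2)

theorem integral_norm_timeMollify_slice_le (T : ℝ) {ρ : ℝ → ℝ} (hρ : Continuous ρ) {C : ℝ≥0}
    (hC : ∀ r, ‖ρ r‖ ≤ C) {F : X × ℝ → V} (hF : StronglyMeasurable F)
    (hFi : Integrable F (μ.prod (timeMeasure T))) (t : ℝ) :
    ∫ x, ‖timeMollify T ρ F x t‖ ∂μ ≤ C * ∫ z, ‖F z‖ ∂(μ.prod (timeMeasure T)) := by
  rw [integral_norm_eq_lintegral_enorm
      (stronglyMeasurable_timeMollify_slice T hρ hF t).aestronglyMeasurable,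
    integral_norm_eq_lintegral_enorm hFi.1, ← ENNReal.coe_toReal, ← ENNReal.toReal_mul]
  exact ENNReal.toReal_mono (ENNReal.mul_lt_top ENNReal.coe_lt_top hFi.2).ne
    (lintegral_enorm_timeMollify_slice_le T hC hF t)

/-- Young's inequality in time, uniformly in x: exchange the t and s integrals by Tonelli, enlarge
the t-domain from (0,T) to the whole line, and use translation invariance. -/
theorem lintegral_enorm_timeMollify_le (T : ℝ) {ρ : ℝ → ℝ} (hρ : Continuous ρ)
    {F : X × ℝ → V} (hF : StronglyMeasurable F) :
    ∫⁻ z, ‖timeMollify T ρ F z.1 z.2‖ₑ ∂(μ.prod (timeMeasure T)) ≤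
      (∫⁻ r, ‖ρ r‖ₑ) * ∫⁻ z, ‖F z‖ₑ ∂(μ.prod (timeMeasure T)) := by
  have hm := hF.enorm
  rw [lintegral_prod _ hF.enorm.aemeasurable,
    lintegral_prod _ (stronglyMeasurable_timeMollify T hρ hF).enorm.aemeasurable,
    ← lintegral_const_mul _ hF.enorm.lintegral_prod_right']
  refine lintegral_mono fun x => ?_
  have hρm : Measurable ρ := hρ.measurable
  calc ∫⁻ t, ‖timeMollify T ρ F x t‖ₑ ∂(timeMeasure T)
      ≤ ∫⁻ t, ∫⁻ s, ‖ρ (t - s)‖ₑ * ‖F (x, s)‖ₑ ∂(timeMeasure T) ∂(timeMeasure T) :=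
        lintegral_mono fun t => enorm_timeMollify_le T ρ F x t
    _ = ∫⁻ s, ∫⁻ t, ‖ρ (t - s)‖ₑ * ‖F (x, s)‖ₑ ∂(timeMeasure T) ∂(timeMeasure T) := by
        apply lintegral_lintegral_swap
        have h1 : Measurable (fun p : ℝ × ℝ => ‖ρ (p.1 - p.2)‖ₑ) := by fun_prop
        refine (h1.mul ?_).aemeasurable
        exact hm.comp (g := fun z => ‖F z‖ₑ) (f := fun p : ℝ × ℝ => (x, p.2)) (by fun_prop)
    _ ≤ ∫⁻ s, (∫⁻ r, ‖ρ r‖ₑ) * ‖F (x, s)‖ₑ ∂(timeMeasure T) := by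
        refine lintegral_mono fun s => ?_
        rw [lintegral_mul_const _ (by fun_prop)]
        gcongr ?_ * _
        refine (setLIntegral_le_lintegral _ _).trans_eq ?_
        exact lintegral_sub_right_eq_self (fun r => ‖ρ r‖ₑ) s
    _ = (∫⁻ r, ‖ρ r‖ₑ) * ∫⁻ s, ‖F (x, s)‖ₑ ∂(timeMeasure T) :=
        lintegral_const_mul _ (hm.comp (by fun_prop))

theorem integrable_timeMollify (T : ℝ) {ρ : ℝ → ℝ} (hρ : Continuous ρ)
    (hc : HasCompactSupport ρ) {F : X × ℝ → V} (hF : StronglyMeasurable F)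
    (hFi : Integrable F (μ.prod (timeMeasure T))) :
    Integrable (fun z : X × ℝ => timeMollify T ρ F z.1 z.2) (μ.prod (timeMeasure T)) := by
  refine ⟨(stronglyMeasurable_timeMollify T hρ hF).aestronglyMeasurable, ?_⟩
  exact (lintegral_enorm_timeMollify_le T hρ hF).trans_lt
    (ENNReal.mul_lt_top (hρ.integrable_of_hasCompactSupport hc).2 hFi.2)

/-- The kernel is bounded, so the exceptional null set depends only on the integrability of F(x,·).
It therefore serves all t at once, as pointwise differentiation in t requires. -/
theorem ae_integrable_timeMollify_integrand (T : ℝ) {ρ : ℝ → ℝ} (hρ : Continuous ρ)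
    (hc : HasCompactSupport ρ) {F : X × ℝ → V}
    (hFi : Integrable F (μ.prod (timeMeasure T))) :
    ∀ᵐ x ∂μ, ∀ t, Integrable (fun s => ρ (t - s) • F (x, s)) (timeMeasure T) := by
  obtain ⟨C, hC⟩ := exists_bound_of_hasCompactSupport hρ hc
  filter_upwards [hFi.prod_right_ae] with x hx t
  exact hx.bdd_smul C (by fun_prop) (ae_of_all _ fun s => hC _)

theorem timeMollify_sub_ae (T : ℝ) {ρ : ℝ → ℝ} (hρ : Continuous ρ)
    (hc : HasCompactSupport ρ) {F F' : X × ℝ → V}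
    (hFi : Integrable F (μ.prod (timeMeasure T)))
    (hFi' : Integrable F' (μ.prod (timeMeasure T))) :
    ∀ᵐ x ∂μ, ∀ t, timeMollify T ρ (fun z => F z - F' z) x t =
      timeMollify T ρ F x t - timeMollify T ρ F' x t := by
  filter_upwards [ae_integrable_timeMollify_integrand T hρ hc hFi,
    ae_integrable_timeMollify_integrand T hρ hc hFi'] with x hx hx' t
  unfold timeMollify
  rw [← integral_sub (hx t) (hx' t)]
  simp [smul_sub]

/-- Makes the difference of two mollifications a single mollification with a signed kernel, so that
an a priori bound for general kernels becomes a Cauchy estimate. -/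
theorem timeMollify_kernel_sub_ae (T : ℝ) {ρ ρ' : ℝ → ℝ} (hρ : Continuous ρ)
    (hc : HasCompactSupport ρ) (hρ' : Continuous ρ') (hc' : HasCompactSupport ρ')
    {F : X × ℝ → V} (hFi : Integrable F (μ.prod (timeMeasure T))) :
    ∀ᵐ x ∂μ, ∀ t, timeMollify T (fun r => ρ r - ρ' r) F x t =
      timeMollify T ρ F x t - timeMollify T ρ' F x t := by
  filter_upwards [ae_integrable_timeMollify_integrand T hρ hc hFi,
    ae_integrable_timeMollify_integrand T hρ' hc' hFi] with x hx hx' t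
  unfold timeMollify
  rw [← integral_sub (hx t) (hx' t)]
  simp [sub_smul]

/-- Fubini's theorem for time mollifications paired with a function of the space variable. -/
theorem integral_inner_timeMollify {H : Type*} [NormedAddCommGroup H] [InnerProductSpace ℝ H]
    [CompleteSpace H] (T : ℝ) {ρ : ℝ → ℝ} (hρ : Continuous ρ)
    (hc : HasCompactSupport ρ) {F : X × ℝ → H}
    (hFi : Integrable F (μ.prod (timeMeasure T))) (t : ℝ) {p : X → H}
    (hp : Integrable (fun z : X × ℝ => inner ℝ (p z.1) (F z)) (μ.prod (timeMeasure T))) :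
    ∫ x, inner ℝ (p x) (timeMollify T ρ F x t) ∂μ =
      ∫ z, ρ (t - z.2) * inner ℝ (p z.1) (F z) ∂(μ.prod (timeMeasure T)) := by
  obtain ⟨C, hC⟩ := exists_bound_of_hasCompactSupport hρ hc
  have hi : Integrable (fun z : X × ℝ => ρ (t - z.2) * inner ℝ (p z.1) (F z))
      (μ.prod (timeMeasure T)) :=
    hp.bdd_mul (c := C) (Continuous.aestronglyMeasurable (by fun_prop) |>.comp_measurable
      (f := fun z : X × ℝ => z.2) (g := fun s => ρ (t - s)) (by fun_prop))
      (ae_of_all _ fun s => hC _)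
  rw [integral_prod _ hi]
  refine integral_congr_ae ?_
  filter_upwards [ae_integrable_timeMollify_integrand T hρ hc hFi] with x hx
  unfold timeMollify
  rw [← integral_inner (hx t)]
  simp [inner_smul_right]

end TimeMollification

/-! ### Mollification in time: L_2 slices, time derivative, convergence of approximate identities.
-/

section TimeMollificationLimits

variable {X V : Type*} [MeasurableSpace X] [NormedAddCommGroup V] [NormedSpace ℝ V]
variable {μ : Measure X} [SFinite μ]

/-- Cauchy–Schwarz in time against the constant bound of the kernel; the finite length of (0,T)
enters here. -/
theorem memLp_two_timeMollify_slice (T : ℝ) {ρ : ℝ → ℝ} (hρ : Continuous ρ)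
    (hc : HasCompactSupport ρ) {F : X × ℝ → V} (hF : StronglyMeasurable F)
    (hFi : MemLp F 2 (μ.prod (timeMeasure T))) (t : ℝ) :
    MemLp (fun x => timeMollify T ρ F x t) 2 μ := by
  obtain ⟨C, hC⟩ := exists_bound_of_hasCompactSupport hρ hc
  refine ⟨(stronglyMeasurable_timeMollify_slice T hρ hF t).aestronglyMeasurable, ?_⟩
  rw [eLpNorm_lt_top_iff_lintegral_rpow_enorm_lt_top (by simp) (by simp)]
  have hfin := (eLpNorm_lt_top_iff_lintegral_rpow_enorm_lt_top (by simp) (by simp)).1 hFi.2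
  simp only [ENNReal.toReal_ofNat] at hfin ⊢
  have hm : Measurable (fun z => ‖F z‖ₑ ^ (2 : ℝ)) := hF.enorm.pow_const _
  rw [lintegral_prod _ hm.aemeasurable] at hfin
  have hT : timeMeasure T univ < ⊤ := by simp
  have key : ∀ x, ‖timeMollify T ρ F x t‖ₑ ^ (2 : ℝ) ≤
      ((C : ℝ≥0∞) ^ (2 : ℝ) * timeMeasure T univ) *
        ∫⁻ s, ‖F (x, s)‖ₑ ^ (2 : ℝ) ∂(timeMeasure T) := by
    intro x
    have hmx : Measurable (fun s => ‖F (x, s)‖ₑ) :=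
      hF.enorm.comp (f := fun s : ℝ => (x, s)) (by fun_prop)
    have h1 : ‖timeMollify T ρ F x t‖ₑ ≤
        ∫⁻ s, ‖F (x, s)‖ₑ * (C : ℝ≥0∞) ∂(timeMeasure T) := by
      refine (enorm_timeMollify_le T ρ F x t).trans (lintegral_mono fun s => ?_)
      rw [mul_comm]
      gcongr
      rw [← ofReal_norm, ← ENNReal.ofReal_coe_nnreal]
      exact ENNReal.ofReal_le_ofReal (hC _)
    have h2 := ENNReal.lintegral_mul_le_Lp_mul_Lq (timeMeasure T)
      (Real.HolderConjugate.two_two) hmx.aemeasurable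
      (aemeasurable_const (b := (C : ℝ≥0∞)))
    calc ‖timeMollify T ρ F x t‖ₑ ^ (2 : ℝ)
        ≤ ((∫⁻ s, ‖F (x, s)‖ₑ ^ (2 : ℝ) ∂(timeMeasure T)) ^ (1 / (2 : ℝ)) *
            (∫⁻ s, (C : ℝ≥0∞) ^ (2 : ℝ) ∂(timeMeasure T)) ^ (1 / (2 : ℝ))) ^ (2 : ℝ) :=
          ENNReal.rpow_le_rpow (h1.trans h2) (by norm_num)
      _ = _ := by
          rw [ENNReal.mul_rpow_of_nonneg _ _ (by norm_num), ← ENNReal.rpow_mul,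
            ← ENNReal.rpow_mul, lintegral_const]
          norm_num
          ring
  calc ∫⁻ x, ‖timeMollify T ρ F x t‖ₑ ^ (2 : ℝ) ∂μ
      ≤ ∫⁻ x, ((C : ℝ≥0∞) ^ (2 : ℝ) * timeMeasure T univ) *
        ∫⁻ s, ‖F (x, s)‖ₑ ^ (2 : ℝ) ∂(timeMeasure T) ∂μ := lintegral_mono key
    _ = ((C : ℝ≥0∞) ^ (2 : ℝ) * timeMeasure T univ) *
        ∫⁻ x, ∫⁻ s, ‖F (x, s)‖ₑ ^ (2 : ℝ) ∂(timeMeasure T) ∂μ :=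
        lintegral_const_mul _ hm.lintegral_prod_right'
    _ < ⊤ := ENNReal.mul_lt_top (ENNReal.mul_lt_top (by simp) hT) hfin

theorem hasDerivAt_timeMollify_ae (T : ℝ) {ρ : ℝ → ℝ} (hρ : ContDiff ℝ ∞ ρ)
    (hc : HasCompactSupport ρ) {F : X × ℝ → V}
    (hFi : Integrable F (μ.prod (timeMeasure T))) :
    ∀ᵐ x ∂μ, ∀ t, HasDerivAt (timeMollify T ρ F x) (timeMollify T (deriv ρ) F x t) t := by
  have hρ' : Continuous (deriv ρ) := hρ.continuous_deriv (by simp)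
  obtain ⟨C, hC⟩ := exists_bound_of_hasCompactSupport hρ' hc.deriv
  filter_upwards [hFi.prod_right_ae, ae_integrable_timeMollify_integrand T hρ.continuous hc hFi]
    with x hx hx' t
  refine (hasDerivAt_integral_of_dominated_loc_of_deriv_le (F := fun t s => ρ (t - s) • F (x, s))
    (F' := fun t s => deriv ρ (t - s) • F (x, s)) (bound := fun s => C * ‖F (x, s)‖)
    (s := univ) univ_mem (Eventually.of_forall fun t => (hx' t).1) (hx' t) ?_ ?_ ?_ ?_).2
  · exact AEStronglyMeasurable.smul (Continuous.aestronglyMeasurable (by fun_prop)) hx.1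
  · refine ae_of_all _ fun s t _ => ?_
    rw [norm_smul]
    exact mul_le_mul_of_nonneg_right (hC _) (norm_nonneg _)
  · exact hx.norm.const_mul _
  · refine ae_of_all _ fun s t _ => ?_
    have h : HasDerivAt ρ (deriv ρ (t - s)) (t - s) :=
      (hρ.differentiable (by simp) _).hasDerivAt
    exact (h.comp_sub_const t s).smul_const _

theorem integral_norm_timeMollify_le (T : ℝ) {ρ : ℝ → ℝ} (hρ : Continuous ρ)
    (hc : HasCompactSupport ρ) {F : X × ℝ → V} (hF : StronglyMeasurable F)
    (hFi : Integrable F (μ.prod (timeMeasure T))) :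
    ∫ z, ‖timeMollify T ρ F z.1 z.2‖ ∂(μ.prod (timeMeasure T)) ≤
      (∫ r, ‖ρ r‖) * ∫ z, ‖F z‖ ∂(μ.prod (timeMeasure T)) := by
  have hi := hρ.integrable_of_hasCompactSupport (μ := volume) hc
  rw [integral_norm_eq_lintegral_enorm
      (stronglyMeasurable_timeMollify T hρ hF).aestronglyMeasurable,
    integral_norm_eq_lintegral_enorm hFi.1, integral_norm_eq_lintegral_enorm hi.1,
    ← ENNReal.toReal_mul]
  exact ENNReal.toReal_mono (ENNReal.mul_lt_top hi.2 hFi.2).ne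
    (lintegral_enorm_timeMollify_le T hρ hF)

/-- A smooth probability density concentrated near `1 / (m + 1)`, to the right of `0`. -/
def timeKernelBump (m : ℕ) : ContDiffBump (1 / ((m : ℝ) + 1)) where
  rIn := 1 / ((m : ℝ) + 1) / 4
  rOut := 1 / ((m : ℝ) + 1) / 2
  rIn_pos := by positivity
  rIn_lt_rOut := by
    have : 0 < 1 / ((m : ℝ) + 1) := by positivity
    linarith

/-- The time-mollification kernels. -/
def timeKernel (m : ℕ) : ℝ → ℝ := (timeKernelBump m).normed volume

theorem timeKernel_nonneg (m : ℕ) (r : ℝ) : 0 ≤ timeKernel m r :=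
  (timeKernelBump m).nonneg_normed r

theorem integral_timeKernel (m : ℕ) : ∫ r, timeKernel m r = 1 :=
  (timeKernelBump m).integral_normed

/-- The center is 1/(m+1) and the outer radius half of that, so the support stays strictly to the
right of 0: the mollification at time t sees only times before t. -/
theorem tsupport_timeKernel_subset (m : ℕ) :
    tsupport (timeKernel m) ⊆ Ioo 0 (2 * (1 / ((m : ℝ) + 1))) := by
  unfold timeKernel
  rw [(timeKernelBump m).tsupport_normed_eq, Real.closedBall_eq_Icc]
  have : 0 < 1 / ((m : ℝ) + 1) := by positivity
  intro r hr
  simp only [timeKernelBump, mem_Icc] at hr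
  constructor <;> linarith [hr.1, hr.2]

theorem isTestFunction_timeKernel (m : ℕ) : IsTestFunction (Ioi 0) (timeKernel m) where
  contDiff := (timeKernelBump m).contDiff_normed
  hasCompactSupport := (timeKernelBump m).hasCompactSupport_normed
  tsupport_subset := (tsupport_timeKernel_subset m).trans Ioo_subset_Ioi_self

theorem integral_norm_timeKernel (m : ℕ) : ∫ r, ‖timeKernel m r‖ = 1 := by
  simp_rw [Real.norm_of_nonneg (timeKernel_nonneg m _)]
  exact integral_timeKernel m

theorem eventually_tsupport_timeKernel_subset {t : ℝ} (ht : 0 < t) :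
    ∀ᶠ m in atTop, tsupport (timeKernel m) ⊆ Ioo 0 t := by
  have h : Tendsto (fun m : ℕ => 2 * (1 / ((m : ℝ) + 1))) atTop (𝓝 (2 * 0)) :=
    tendsto_one_div_add_atTop_nhds_zero_nat.const_mul 2
  rw [mul_zero] at h
  filter_upwards [h.eventually_lt_const ht] with m hm
  exact (tsupport_timeKernel_subset m).trans (Ioo_subset_Ioo_right hm.le)

/-- With support in (0,t) and t ≤ T, the reflected kernel lives inside (0,T), so cutting off to
(0,T) loses no mass. -/
theorem integral_kernel_timeMeasure {T t : ℝ} (htT : t ≤ T) {ρ : ℝ → ℝ}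
    (hs : tsupport ρ ⊆ Ioo 0 t) : ∫ s, ρ (t - s) ∂(timeMeasure T) = ∫ r, ρ r := by
  rw [setIntegral_eq_integral_of_forall_compl_eq_zero, integral_sub_left_eq_self ρ volume t]
  intro s hsT
  by_contra h
  have := hs (subset_tsupport ρ h)
  exact hsT ⟨by linarith [this.2], by linarith [this.1]⟩

theorem tendsto_timeMollify_of_continuousAt {T : ℝ} {F : X × ℝ → ℝ} {x : X} {t : ℝ}
    (ht : t ∈ Ioo 0 T) (hF : Continuous fun s => F (x, s)) :
    Tendsto (fun m => timeMollify T (timeKernel m) F x t) atTop (𝓝 (F (x, t))) := by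
  rw [Metric.tendsto_nhds]
  intro ε hε
  obtain ⟨δ, hδ, hd⟩ := Metric.continuousAt_iff.1 (hF.continuousAt (x := t)) (ε / 2) (by positivity)
  filter_upwards [eventually_tsupport_timeKernel_subset ht.1,
    eventually_tsupport_timeKernel_subset hδ] with m hm hmδ
  have hρ := isTestFunction_timeKernel m
  have hint1 : Integrable (fun s => timeKernel m (t - s)) (timeMeasure T) :=
    ((hρ.contDiff.continuous.integrable_of_hasCompactSupport hρ.hasCompactSupport
      (μ := volume)).comp_sub_left t).integrableOn
  have hsupp : HasCompactSupport (fun s => timeKernel m (t - s)) :=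
    hρ.hasCompactSupport.comp_homeomorph (Homeomorph.subLeft t)
  have hint2 : Integrable (fun s => timeKernel m (t - s) • F (x, s)) (timeMeasure T) := by
    have hk : Continuous (fun s => timeKernel m (t - s)) :=
      hρ.contDiff.continuous.comp (by fun_prop)
    exact ((hk.smul hF).integrable_of_hasCompactSupport hsupp.smul_right).integrableOn
  have hone := integral_kernel_timeMeasure ht.2.le hm
  rw [integral_timeKernel] at hone
  have heq : timeMollify T (timeKernel m) F x t - F (x, t) =
      ∫ s, timeKernel m (t - s) * (F (x, s) - F (x, t)) ∂(timeMeasure T) := by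
    unfold timeMollify
    simp only [smul_eq_mul] at hint2 ⊢
    simp_rw [mul_sub]
    rw [integral_sub hint2 (hint1.mul_const _), integral_mul_const, hone, one_mul]
  rw [Real.dist_eq, heq, ← Real.norm_eq_abs]
  refine lt_of_le_of_lt (norm_integral_le_of_norm_le (g := fun s => timeKernel m (t - s) * (ε / 2))
    (hint1.mul_const _) (ae_of_all _ fun s => ?_)) ?_
  · rw [norm_mul, Real.norm_of_nonneg (timeKernel_nonneg m _)]
    by_cases h0 : timeKernel m (t - s) = 0
    · simp [h0]
    · refine mul_le_mul_of_nonneg_left ?_ (timeKernel_nonneg m _)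
      have h1 := hmδ (subset_tsupport _ h0)
      have := hd (x := s) (by rw [Real.dist_eq, abs_lt]; constructor <;> linarith [h1.1, h1.2])
      exact this.le
  · rw [integral_mul_const, hone]
    linarith

end TimeMollificationLimits

/-- Time mollifications of an integrable function converge to it in `L_1`. -/
theorem tendsto_integral_norm_timeMollify_sub {n : ℕ} {μ : Measure (E n)} [IsFiniteMeasure μ]
    (T : ℝ) {F : E n × ℝ → ℝ} (hF : StronglyMeasurable F)
    (hFi : Integrable F (μ.prod (timeMeasure T))) :
    Tendsto (fun m => ∫ z, ‖timeMollify T (timeKernel m) F z.1 z.2 - F z‖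
      ∂(μ.prod (timeMeasure T))) atTop (𝓝 0) := by
  set π := μ.prod (timeMeasure T) with hπ
  rw [Metric.tendsto_nhds]
  intro ε hε
  obtain ⟨K, hK, hKi⟩ := hFi.exists_boundedContinuous_integral_sub_le (ε := ε / 4) (by positivity)
  have hKs : StronglyMeasurable (fun z => K z) := K.continuous.stronglyMeasurable
  have hlim : Tendsto (fun m => ∫ z, ‖timeMollify T (timeKernel m) K z.1 z.2 - K z‖ ∂π)
      atTop (𝓝 (∫ z, (0 : ℝ) ∂π)) := by
    refine tendsto_integral_of_dominated_convergence (fun _ => ‖K‖ + ‖K‖) ?_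
      (integrable_const _) ?_ ?_
    · intro m
      exact ((stronglyMeasurable_timeMollify T
        (isTestFunction_timeKernel m).contDiff.continuous hKs).sub
          hKs).norm.aestronglyMeasurable
    · intro m
      refine ae_of_all _ fun z => ?_
      rw [norm_norm]
      refine (norm_sub_le _ _).trans (add_le_add ?_ (K.norm_coe_le_norm z))
      have hρ := isTestFunction_timeKernel m
      have hint1 : Integrable (fun s => timeKernel m (z.2 - s)) volume :=
        (hρ.contDiff.continuous.integrable_of_hasCompactSupport hρ.hasCompactSupport
          (μ := volume)).comp_sub_left z.2
      refine (norm_integral_le_of_norm_le (g := fun s => timeKernel m (z.2 - s) * ‖K‖)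
        (hint1.integrableOn.mul_const _) (ae_of_all _ fun s => ?_)).trans ?_
      · rw [norm_smul, Real.norm_of_nonneg (timeKernel_nonneg m _)]
        exact mul_le_mul_of_nonneg_left (K.norm_coe_le_norm _) (timeKernel_nonneg m _)
      · rw [integral_mul_const]
        refine mul_le_of_le_one_left (norm_nonneg _) ?_
        refine (setIntegral_le_integral hint1
          (ae_of_all _ fun s => timeKernel_nonneg m _)).trans_eq ?_
        rw [integral_sub_left_eq_self (timeKernel m) volume z.2, integral_timeKernel]
    · have h2 : ∀ᵐ z ∂π, z.2 ∈ Ioo 0 T := by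
        have : ∀ᵐ t ∂(timeMeasure T), t ∈ Ioo 0 T := ae_restrict_mem measurableSet_Ioo
        exact Measure.quasiMeasurePreserving_snd.ae this
      filter_upwards [h2] with z hz
      have := tendsto_timeMollify_of_continuousAt (F := fun z => K z) (x := z.1) hz
        (K.continuous.comp (by fun_prop))
      simpa using (this.sub_const (K z)).norm
  rw [integral_zero] at hlim
  filter_upwards [hlim.eventually_lt_const (show (0 : ℝ) < ε / 4 by positivity)] with m hm
  have hρ := isTestFunction_timeKernel m
  have hc := hρ.contDiff.continuous
  have hsub := timeMollify_sub_ae (μ := μ) T hc hρ.hasCompactSupport hFi hKi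
  have hsub' : ∀ᵐ z ∂π, timeMollify T (timeKernel m) (fun z => F z - K z) z.1 z.2 =
      timeMollify T (timeKernel m) F z.1 z.2 - timeMollify T (timeKernel m) K z.1 z.2 := by
    filter_upwards [Measure.quasiMeasurePreserving_fst.ae hsub] with z hz
    exact hz z.2
  have hI1 := integrable_timeMollify (μ := μ) T hc hρ.hasCompactSupport (hF.sub hKs)
    (hFi.sub hKi)
  have hI2 := integrable_timeMollify (μ := μ) T hc hρ.hasCompactSupport hKs hKi
  have hI3 := integrable_timeMollify (μ := μ) T hc hρ.hasCompactSupport hF hFi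
  have hcontr := integral_norm_timeMollify_le (μ := μ) T hc hρ.hasCompactSupport (hF.sub hKs)
    (hFi.sub hKi)
  rw [integral_norm_timeKernel, one_mul] at hcontr
  rw [Real.dist_eq, sub_zero, abs_of_nonneg (integral_nonneg fun z => norm_nonneg _)]
  calc ∫ z, ‖timeMollify T (timeKernel m) F z.1 z.2 - F z‖ ∂π
      ≤ ∫ z, (‖timeMollify T (timeKernel m) (fun z => F z - K z) z.1 z.2‖ +
          ‖timeMollify T (timeKernel m) K z.1 z.2 - K z‖ + ‖F z - K z‖) ∂π := by
        refine integral_mono_ae (hI3.sub hFi).norm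
          ((hI1.norm.add (hI2.sub hKi).norm).add (hFi.sub hKi).norm) ?_
        filter_upwards [hsub'] with z hz
        rw [hz]
        set A := timeMollify T (timeKernel m) F z.1 z.2
        set B := timeMollify T (timeKernel m) K z.1 z.2
        calc ‖A - F z‖ = ‖(A - B) + (B - K z) - (F z - K z)‖ := by congr 1; ring
          _ ≤ ‖(A - B) + (B - K z)‖ + ‖F z - K z‖ := norm_sub_le _ _
          _ ≤ _ := by gcongr; exact norm_add_le _ _
    _ = ∫ z, ‖timeMollify T (timeKernel m) (fun z => F z - K z) z.1 z.2‖ ∂π +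
          ∫ z, ‖timeMollify T (timeKernel m) K z.1 z.2 - K z‖ ∂π + ∫ z, ‖F z - K z‖ ∂π := by
        have e1 := integral_add (hI1.norm.add (hI2.sub hKi).norm) (hFi.sub hKi).norm
        have e2 := integral_add hI1.norm (hI2.sub hKi).norm
        exact e1.trans (congrArg (· + _) e2)
    _ < ε := by
        have : ∫ z, ‖timeMollify T (timeKernel m) (fun z => F z - K z) z.1 z.2‖ ∂π ≤ ε / 4 :=
          hcontr.trans hK
        linarith

/-! ### Cauchy–Schwarz for square-integrable functions. -/

section SquareIntegrable

variable {X V W : Type*} [MeasurableSpace X] [NormedAddCommGroup V] [NormedAddCommGroup W]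
  {μ : Measure X}

theorem integrable_norm_mul_norm {a : X → V} {d : X → W} (ha : MemLp a 2 μ) (hd : MemLp d 2 μ) :
    Integrable (fun x => ‖a x‖ * ‖d x‖) μ :=
  ha.norm.integrable_mul hd.norm

theorem integral_norm_mul_norm_le {a : X → V} {d : X → W} (ha : MemLp a 2 μ) (hd : MemLp d 2 μ) :
    ∫ x, ‖a x‖ * ‖d x‖ ∂μ ≤ (eLpNorm a 2 μ).toReal * (eLpNorm d 2 μ).toReal := by
  have h := ENNReal.lintegral_mul_le_Lp_mul_Lq μ Real.HolderConjugate.two_two ha.1.enorm hd.1.enorm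
  have e1 : eLpNorm a 2 μ = (∫⁻ x, ‖a x‖ₑ ^ (2 : ℝ) ∂μ) ^ (1 / (2 : ℝ)) := by
    rw [eLpNorm_eq_lintegral_rpow_enorm_toReal (by simp) (by simp)]; simp
  have e2 : eLpNorm d 2 μ = (∫⁻ x, ‖d x‖ₑ ^ (2 : ℝ) ∂μ) ^ (1 / (2 : ℝ)) := by
    rw [eLpNorm_eq_lintegral_rpow_enorm_toReal (by simp) (by simp)]; simp
  rw [← e1, ← e2] at h
  rw [← ENNReal.toReal_mul, integral_eq_lintegral_of_nonneg_ae
    (ae_of_all _ fun x => by positivity) (integrable_norm_mul_norm ha hd).1]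
  refine ENNReal.toReal_mono (ENNReal.mul_lt_top ha.2 hd.2).ne (le_trans (le_of_eq ?_) h)
  refine lintegral_congr fun x => ?_
  simp [ENNReal.ofReal_mul]

theorem tendsto_integral_norm_mul_norm {a : X → V} {d : ℕ → X → W} (ha : MemLp a 2 μ)
    (hd : ∀ k, MemLp (d k) 2 μ) (hlim : Tendsto (fun k => eLpNorm (d k) 2 μ) atTop (𝓝 0)) :
    Tendsto (fun k => ∫ x, ‖a x‖ * ‖d k x‖ ∂μ) atTop (𝓝 0) := by
  have h : Tendsto (fun k => (eLpNorm a 2 μ).toReal * (eLpNorm (d k) 2 μ).toReal) atTop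
      (𝓝 ((eLpNorm a 2 μ).toReal * (0 : ℝ≥0∞).toReal)) :=
    ((ENNReal.tendsto_toReal (by simp)).comp hlim).const_mul _
  simp only [ENNReal.toReal_zero, mul_zero] at h
  exact squeeze_zero (fun k => integral_nonneg fun x => by positivity)
    (fun k => integral_norm_mul_norm_le ha (hd k)) h

theorem integrable_inner_of_memLp_two {H : Type*} [NormedAddCommGroup H] [InnerProductSpace ℝ H]
    {a d : X → H} (ha : MemLp a 2 μ) (hd : MemLp d 2 μ) :
    Integrable (fun x => inner ℝ (a x) (d x)) μ :=
  (integrable_norm_mul_norm ha hd).mono' (ha.1.inner hd.1)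
    (ae_of_all _ fun _ => norm_inner_le_norm _ _)

end SquareIntegrable

/-! ### Calculus of test functions. -/

section TestFunctions

variable {n : ℕ} {Ω : Set (E n)} {φ ψ : E n → ℝ}

theorem IsTestFunction.comp_smooth {V : Type*} [NormedAddCommGroup V] [NormedSpace ℝ V]
    {U : Set V} {φ : V → ℝ} (hφ : IsTestFunction U φ) {S : ℝ → ℝ}
    (hS : ContDiff ℝ ∞ S) (h0 : S 0 = 0) : IsTestFunction U (fun x => S (φ x)) where
  contDiff := hS.comp hφ.contDiff
  hasCompactSupport := hφ.hasCompactSupport.comp_left h0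
  tsupport_subset := (closure_mono (Function.support_comp_subset h0 φ)).trans hφ.tsupport_subset

theorem IsTestFunction.zero {V : Type*} [NormedAddCommGroup V] [NormedSpace ℝ V]
    (U : Set V) : IsTestFunction U (fun _ => (0 : ℝ)) where
  contDiff := contDiff_const
  hasCompactSupport := HasCompactSupport.zero
  tsupport_subset := by simp [tsupport]

theorem IsTestFunction.add {V : Type*} [NormedAddCommGroup V] [NormedSpace ℝ V]
    {U : Set V} {φ ψ : V → ℝ} (hφ : IsTestFunction U φ) (hψ : IsTestFunction U ψ) :
    IsTestFunction U (fun x => φ x + ψ x) where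
  contDiff := hφ.contDiff.add hψ.contDiff
  hasCompactSupport := hφ.hasCompactSupport.add hψ.hasCompactSupport
  tsupport_subset := (tsupport_add φ ψ).trans
    (union_subset hφ.tsupport_subset hψ.tsupport_subset)

theorem IsTestFunction.const_mul {V : Type*} [NormedAddCommGroup V] [NormedSpace ℝ V]
    {U : Set V} {φ : V → ℝ} (hφ : IsTestFunction U φ) (c : ℝ) :
    IsTestFunction U (fun x => c * φ x) :=
  hφ.comp_smooth (S := fun r => c * r) (by fun_prop) (by simp)

theorem IsTestFunction.sub {V : Type*} [NormedAddCommGroup V] [NormedSpace ℝ V]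
    {U : Set V} {φ ψ : V → ℝ} (hφ : IsTestFunction U φ) (hψ : IsTestFunction U ψ) :
    IsTestFunction U (fun x => φ x - ψ x) := by
  simpa [sub_eq_add_neg] using hφ.add (hψ.const_mul (-1))

theorem gradient_eq_toDual_symm (φ : E n → ℝ) :
    gradient φ = fun x => (InnerProductSpace.toDual ℝ (E n)).symm (fderiv ℝ φ x) := rfl

theorem IsTestFunction.differentiable (hφ : IsTestFunction Ω φ) : Differentiable ℝ φ :=
  hφ.contDiff.differentiable (by simp)

theorem IsTestFunction.contDiff_gradient (hφ : IsTestFunction Ω φ) :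
    ContDiff ℝ ∞ (gradient φ) := by
  rw [gradient_eq_toDual_symm]
  exact (InnerProductSpace.toDual ℝ (E n)).symm.contDiff.comp
    (hφ.contDiff.fderiv_right (m := ∞) (by simp))

theorem IsTestFunction.hasCompactSupport_gradient (hφ : IsTestFunction Ω φ) :
    HasCompactSupport (gradient φ) := by
  rw [gradient_eq_toDual_symm]
  exact (hφ.hasCompactSupport.fderiv ℝ).comp_left
    (g := (InnerProductSpace.toDual ℝ (E n)).symm) (by simp)

theorem IsTestFunction.memLp {μ : Measure (E n)} [IsFiniteMeasure μ] (hφ : IsTestFunction Ω φ)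
    (p : ℝ≥0∞) : MemLp φ p μ :=
  hφ.contDiff.continuous.memLp_of_hasCompactSupport hφ.hasCompactSupport

theorem IsTestFunction.memLp_gradient {μ : Measure (E n)} [IsFiniteMeasure μ]
    (hφ : IsTestFunction Ω φ) (p : ℝ≥0∞) : MemLp (gradient φ) p μ :=
  hφ.contDiff_gradient.continuous.memLp_of_hasCompactSupport hφ.hasCompactSupport_gradient

theorem IsTestFunction.exists_bound (hφ : IsTestFunction Ω φ) : ∃ C, ∀ x, ‖φ x‖ ≤ C :=
  hφ.contDiff.continuous.bounded_above_of_compact_support hφ.hasCompactSupport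

theorem IsTestFunction.gradient_comp (hφ : IsTestFunction Ω φ) {S : ℝ → ℝ}
    (hS : ContDiff ℝ ∞ S) (x : E n) :
    gradient (fun x => S (φ x)) x = deriv S (φ x) • gradient φ x := by
  have h1 := (hS.differentiable (by simp) (φ x)).hasDerivAt.comp_hasFDerivAt x
    (hφ.differentiable x).hasFDerivAt
  simp only [gradient_eq_toDual_symm]
  rw [show fderiv ℝ (fun x => S (φ x)) x = _ from h1.fderiv]
  simp

theorem IsTestFunction.gradient_add (hφ : IsTestFunction Ω φ) (hψ : IsTestFunction Ω ψ)
    (x : E n) : gradient (fun x => φ x + ψ x) x = gradient φ x + gradient ψ x := by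
  simp only [gradient_eq_toDual_symm]
  rw [fderiv_fun_add (hφ.differentiable x) (hψ.differentiable x), map_add]

theorem IsTestFunction.gradient_const_mul (hφ : IsTestFunction Ω φ) (c : ℝ) (x : E n) :
    gradient (fun x => c * φ x) x = c • gradient φ x := by
  simp only [gradient_eq_toDual_symm]
  rw [fderiv_const_mul (hφ.differentiable x), map_smul]

theorem IsTestFunction.gradient_sub (hφ : IsTestFunction Ω φ) (hψ : IsTestFunction Ω ψ)
    (x : E n) : gradient (fun x => φ x - ψ x) x = gradient φ x - gradient ψ x := by
  simp only [gradient_eq_toDual_symm]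
  rw [fderiv_fun_sub (hφ.differentiable x) (hψ.differentiable x), map_sub]

theorem IsTestFunction.setIntegral_eq_integral (hφ : IsTestFunction Ω φ) {w : E n → ℝ} :
    ∫ x in Ω, w x * φ x = ∫ x, w x * φ x := by
  refine setIntegral_eq_integral_of_forall_compl_eq_zero fun x hx => ?_
  rw [image_eq_zero_of_notMem_tsupport fun h => hx (hφ.tsupport_subset h), mul_zero]

/-- The classical Laplacian of a test function represents the Dirichlet form. -/
theorem IsTestFunction.exists_laplacian (hφ : IsTestFunction Ω φ) :
    ∃ q : E n → ℝ, Continuous q ∧ HasCompactSupport q ∧ ∀ ψ, IsTestFunction Ω ψ →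
      ∫ x in Ω, inner ℝ (gradient φ x) (gradient ψ x) = -∫ x in Ω, q x * ψ x := by
  let e := EuclideanSpace.basisFun (Fin n) ℝ
  let D : Fin n → E n → ℝ := fun i x => fderiv ℝ φ x (e i)
  have hD : ∀ i, ContDiff ℝ ∞ (D i) := fun i =>
    (hφ.contDiff.fderiv_right (m := ∞) (by simp)).clm_apply contDiff_const
  have hDc : ∀ i, HasCompactSupport (D i) := fun i =>
    (hφ.hasCompactSupport.fderiv ℝ).comp_left (g := fun L : E n →L[ℝ] ℝ => L (e i)) (by simp)
  have hDD : ∀ i, Continuous (fun x => fderiv ℝ (D i) x (e i)) := fun i =>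
    ((hD i).continuous_fderiv (by simp)).clm_apply continuous_const
  have hDDc : ∀ i, HasCompactSupport (fun x => fderiv ℝ (D i) x (e i)) := fun i =>
    ((hDc i).fderiv ℝ).comp_left (g := fun L : E n →L[ℝ] ℝ => L (e i)) (by simp)
  refine ⟨fun x => ∑ i, fderiv ℝ (D i) x (e i), by fun_prop, ?_, fun ψ hψ => ?_⟩
  · have : ∀ s : Finset (Fin n), HasCompactSupport (fun x => ∑ i ∈ s, fderiv ℝ (D i) x (e i)) := by
      intro s
      induction s using Finset.induction_on with
      | empty =>
        simp only [Finset.sum_empty]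
        exact HasCompactSupport.zero
      | insert a s ha ih =>
        simp_rw [Finset.sum_insert ha]
        exact (hDDc a).add ih
    exact this _
  · have hpt : ∀ x, inner ℝ (gradient φ x) (gradient ψ x) =
        ∑ i, D i x * fderiv ℝ ψ x (e i) := by
      intro x
      rw [← e.sum_inner_mul_inner]
      refine Finset.sum_congr rfl fun i _ => ?_
      congr 1
      · simp [D]
      · rw [real_inner_comm]; simp
    have hψd : ∀ i, Continuous (fun x => fderiv ℝ ψ x (e i)) := fun i =>
      (hψ.contDiff.continuous_fderiv (by simp)).clm_apply continuous_const
    have hout : ∫ x in Ω, inner ℝ (gradient φ x) (gradient ψ x) =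
        ∫ x, inner ℝ (gradient φ x) (gradient ψ x) := by
      refine setIntegral_eq_integral_of_forall_compl_eq_zero fun x hx => ?_
      have : fderiv ℝ ψ x = 0 := image_eq_zero_of_notMem_tsupport fun h =>
        hx (hψ.tsupport_subset (tsupport_fderiv_subset ℝ h))
      simp [gradient_eq_toDual_symm, this]
    rw [hout, hψ.setIntegral_eq_integral]
    simp_rw [hpt, Finset.sum_mul]
    have hc := hψ.contDiff.continuous
    have hi1 : ∀ i, Integrable (fun x => fderiv ℝ (D i) x (e i) * ψ x) volume := fun i =>
      ((hDD i).mul hc).integrable_of_hasCompactSupport (hDDc i).mul_right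
    have hi2 : ∀ i, Integrable (fun x => D i x * fderiv ℝ ψ x (e i)) volume := fun i =>
      ((hD i).continuous.mul (hψd i)).integrable_of_hasCompactSupport (hDc i).mul_right
    rw [integral_finsetSum _ fun i _ => hi1 i, integral_finsetSum _ fun i _ => hi2 i,
      ← Finset.sum_neg_distrib]
    refine Finset.sum_congr rfl fun i _ => ?_
    exact integral_mul_fderiv_eq_neg_fderiv_mul_of_integrable (hi1 i) (hi2 i)
      (((hD i).continuous.mul hc).integrable_of_hasCompactSupport (hDc i).mul_right)
      (fun x _ => (hD i).differentiable (by simp) x) (fun x _ => hψ.differentiable x)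

end TestFunctions

/-! ### The regularized absolute value and its derivatives. -/

/-- A smooth convex approximation of the absolute value. -/
def smoothAbs (ε r : ℝ) : ℝ := √(r ^ 2 + ε ^ 2) - ε

section SmoothAbs

variable {ε : ℝ}

theorem contDiff_smoothAbs (hε : 0 < ε) : ContDiff ℝ ∞ (smoothAbs ε) := by
  unfold smoothAbs
  refine ContDiff.sub (ContDiff.sqrt (by fun_prop) fun r => ?_) contDiff_const
  positivity

theorem smoothAbs_zero (hε : 0 < ε) : smoothAbs ε 0 = 0 := by
  simp [smoothAbs, Real.sqrt_sq hε.le]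

theorem deriv_smoothAbs (hε : 0 < ε) (r : ℝ) : deriv (smoothAbs ε) r = r / √(r ^ 2 + ε ^ 2) := by
  have h : HasDerivAt (fun r : ℝ => r ^ 2 + ε ^ 2) (2 * r) r := by
    simpa using (hasDerivAt_pow 2 r).add_const (ε ^ 2)
  have := (h.sqrt (by positivity)).sub_const ε
  rw [show deriv (smoothAbs ε) r = _ from this.deriv]
  field_simp

theorem deriv_smoothAbs_zero (hε : 0 < ε) : deriv (smoothAbs ε) 0 = 0 := by
  rw [deriv_smoothAbs hε]; simp

theorem contDiff_deriv_smoothAbs (hε : 0 < ε) : ContDiff ℝ ∞ (deriv (smoothAbs ε)) :=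
  (contDiff_infty_iff_deriv.1 (contDiff_smoothAbs hε)).2

theorem abs_deriv_smoothAbs_le (hε : 0 < ε) (r : ℝ) : |deriv (smoothAbs ε) r| ≤ 1 := by
  rw [deriv_smoothAbs hε, abs_div, abs_of_nonneg (Real.sqrt_nonneg _)]
  refine div_le_one_of_le₀ (Real.abs_le_sqrt ?_) (Real.sqrt_nonneg _)
  nlinarith [sq_nonneg ε]

theorem smoothAbs_nonneg (r : ℝ) : 0 ≤ smoothAbs ε r := by
  unfold smoothAbs
  have : ε ≤ √(r ^ 2 + ε ^ 2) := Real.le_sqrt_of_sq_le (by nlinarith [sq_nonneg r])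
  linarith

theorem smoothAbs_le_abs (hε : 0 < ε) (r : ℝ) : smoothAbs ε r ≤ |r| := by
  unfold smoothAbs
  have : √(r ^ 2 + ε ^ 2) ≤ |r| + ε := by
    apply Real.sqrt_le_iff.2
    refine ⟨by positivity, ?_⟩
    nlinarith [sq_abs r, abs_nonneg r]
  linarith

theorem abs_le_smoothAbs_add (r : ℝ) : |r| ≤ smoothAbs ε r + ε := by
  unfold smoothAbs
  have : |r| ≤ √(r ^ 2 + ε ^ 2) := Real.abs_le_sqrt (by nlinarith [sq_nonneg ε])
  linarith

theorem deriv_deriv_smoothAbs (hε : 0 < ε) (r : ℝ) :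
    deriv (deriv (smoothAbs ε)) r = ε ^ 2 / (√(r ^ 2 + ε ^ 2)) ^ 3 := by
  have hp : 0 < r ^ 2 + ε ^ 2 := by positivity
  have hs : 0 < √(r ^ 2 + ε ^ 2) := Real.sqrt_pos.2 hp
  have h : HasDerivAt (fun r : ℝ => r ^ 2 + ε ^ 2) (2 * r) r := by
    simpa using (hasDerivAt_pow 2 r).add_const (ε ^ 2)
  have h2 := (hasDerivAt_id r).div (h.sqrt hp.ne') hs.ne'
  have hfun : deriv (smoothAbs ε) = fun r => r / √(r ^ 2 + ε ^ 2) :=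
    funext (deriv_smoothAbs hε)
  rw [hfun, show deriv (fun r => r / √(r ^ 2 + ε ^ 2)) r = _ from h2.deriv]
  have hsq : √(r ^ 2 + ε ^ 2) ^ 2 = r ^ 2 + ε ^ 2 := Real.sq_sqrt hp.le
  simp only [id]
  field_simp
  rw [hsq]; ring

theorem deriv_deriv_smoothAbs_nonneg (hε : 0 < ε) (r : ℝ) :
    0 ≤ deriv (deriv (smoothAbs ε)) r := by
  rw [deriv_deriv_smoothAbs hε]; positivity

/-- This bound blows up as ε → 0. It serves only at fixed ε, to control the error of approximating
by test functions. -/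
theorem deriv_deriv_smoothAbs_le (hε : 0 < ε) (r : ℝ) :
    deriv (deriv (smoothAbs ε)) r ≤ ε⁻¹ := by
  rw [deriv_deriv_smoothAbs hε]
  have : ε ≤ √(r ^ 2 + ε ^ 2) := Real.le_sqrt_of_sq_le (by nlinarith [sq_nonneg r])
  calc ε ^ 2 / (√(r ^ 2 + ε ^ 2)) ^ 3 ≤ ε ^ 2 / ε ^ 3 := by gcongr
    _ = ε⁻¹ := by field_simp

theorem abs_smoothAbs_sub_le (hε : 0 < ε) (r s : ℝ) :
    |smoothAbs ε r - smoothAbs ε s| ≤ |r - s| := by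
  have h := Convex.norm_image_sub_le_of_norm_deriv_le (f := smoothAbs ε) (C := 1) (s := univ)
    (fun x _ => (contDiff_smoothAbs hε).differentiable (by simp) x)
    (fun x _ => abs_deriv_smoothAbs_le hε x) convex_univ (mem_univ s) (mem_univ r)
  simpa using h

theorem integrable_smoothAbs_comp (hε : 0 < ε) {X : Type*} [MeasurableSpace X] {μ : Measure X}
    {p : X → ℝ} (hp : Integrable p μ) : Integrable (fun x => smoothAbs ε (p x)) μ := by
  refine hp.mono ((contDiff_smoothAbs hε).continuous.comp_aestronglyMeasurable hp.1)
    (ae_of_all _ fun x => ?_)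
  rw [Real.norm_of_nonneg (smoothAbs_nonneg _)]
  exact smoothAbs_le_abs hε _

end SmoothAbs

/-! ### Testing with S'(Z), or with S(Z), for Z in the closure of the test functions. -/

variable {n : ℕ} {Ω : Set (E n)}

/-- `(Z, H)` is the limit in `L_2(Ω)` of `(φ, ∇φ)` for a sequence of test functions `φ`. -/
def IsTestLimit (Ω : Set (E n)) (Z : E n → ℝ) (H : E n → E n) : Prop :=
  ∃ φ : ℕ → E n → ℝ, (∀ k, IsTestFunction Ω (φ k)) ∧
    Tendsto (fun k => eLpNorm (fun x => φ k x - Z x) 2 (volume.restrict Ω)) atTop (𝓝 0) ∧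
    Tendsto (fun k => eLpNorm (fun x => gradient (φ k) x - H x) 2 (volume.restrict Ω))
      atTop (𝓝 0)

theorem IsTestLimit.congr {Z Z' : E n → ℝ} {H H' : E n → E n} (h : IsTestLimit Ω Z H)
    (hZ : Z =ᵐ[volume.restrict Ω] Z') (hH : H =ᵐ[volume.restrict Ω] H') :
    IsTestLimit Ω Z' H' := by
  obtain ⟨φ, hφ, h1, h2⟩ := h
  refine ⟨φ, hφ, h1.congr fun k => eLpNorm_congr_ae ?_, h2.congr fun k => eLpNorm_congr_ae ?_⟩
  · filter_upwards [hZ] with x hx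
    rw [hx]
  · filter_upwards [hH] with x hx
    rw [hx]

theorem IsTestLimit.sub_isTestFunction {Z : E n → ℝ} {H : E n → E n} (h : IsTestLimit Ω Z H)
    {ψ : E n → ℝ} (hψ : IsTestFunction Ω ψ) :
    IsTestLimit Ω (fun x => Z x - ψ x) (fun x => H x - gradient ψ x) := by
  obtain ⟨φ, hφ, h1, h2⟩ := h
  refine ⟨fun k x => φ k x - ψ x, fun k => (hφ k).sub hψ, ?_, ?_⟩
  · simpa using h1
  · simp_rw [(hφ _).gradient_sub hψ]
    simpa using h2

/-- A subsequence of the approximating sequence converges almost everywhere. -/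
theorem IsTestLimit.exists_seq_ae [IsFiniteMeasure (volume.restrict Ω)] {Z : E n → ℝ}
    {H : E n → E n} (h : IsTestLimit Ω Z H) (hZ : MemLp Z 2 (volume.restrict Ω)) :
    ∃ φ : ℕ → E n → ℝ, (∀ k, IsTestFunction Ω (φ k)) ∧
      (∀ᵐ x ∂(volume.restrict Ω), Tendsto (fun k => φ k x) atTop (𝓝 (Z x))) ∧
      Tendsto (fun k => eLpNorm (fun x => gradient (φ k) x - H x) 2 (volume.restrict Ω))
        atTop (𝓝 0) := by
  obtain ⟨φ, hφ, h1, h2⟩ := h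
  have hm : TendstoInMeasure (volume.restrict Ω) φ atTop Z :=
    tendstoInMeasure_of_tendsto_eLpNorm (p := 2) (by simp) (fun k => ((hφ k).memLp 2).1) hZ.1 h1
  obtain ⟨ns, hns, hae⟩ := hm.exists_seq_tendsto_ae
  exact ⟨fun k => φ (ns k), fun k => hφ _, hae, h2.comp hns.tendsto_atTop⟩

/-- Testing a stationary equation with the derivative of a smooth convex function of the
solution. -/
theorem IsTestLimit.integral_mul_deriv_smoothAbs_nonpos [IsFiniteMeasure (volume.restrict Ω)]
    {Z : E n → ℝ} {H : E n → E n} (h : IsTestLimit Ω Z H)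
    (hZ : MemLp Z 2 (volume.restrict Ω)) (hH : MemLp H 2 (volume.restrict Ω))
    {R : E n → ℝ} (hR : Integrable R (volume.restrict Ω)) {ν : ℝ} (hν : 0 < ν)
    (heq : ∀ ψ, IsTestFunction Ω ψ →
      (∫ x in Ω, R x * ψ x) + ν * ∫ x in Ω, inner ℝ (H x) (gradient ψ x) = 0)
    {ε : ℝ} (hε : 0 < ε) :
    ∫ x in Ω, R x * deriv (smoothAbs ε) (Z x) ≤ 0 := by
  obtain ⟨φ, hφ, hae, hg⟩ := h.exists_seq_ae hZ
  set S' := deriv (smoothAbs ε) with hS'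
  have hS'c : ContDiff ℝ ∞ S' := contDiff_deriv_smoothAbs hε
  have hS'b : ∀ r, ‖S' r‖ ≤ 1 := abs_deriv_smoothAbs_le hε
  have hlim : Tendsto (fun k => ∫ x in Ω, R x * S' (φ k x)) atTop
      (𝓝 (∫ x in Ω, R x * S' (Z x))) := by
    refine tendsto_integral_of_dominated_convergence (fun x => ‖R x‖) (fun k => ?_) hR.norm
      (fun k => ae_of_all _ fun x => ?_) ?_
    · exact hR.1.mul (hS'c.continuous.comp (hφ k).contDiff.continuous).aestronglyMeasurable
    · rw [norm_mul]
      exact mul_le_of_le_one_right (norm_nonneg _) (hS'b _)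
    · filter_upwards [hae] with x hx
      exact ((hS'c.continuous.tendsto _).comp hx).const_mul _
  have hd : ∀ k, MemLp (fun x => gradient (φ k) x - H x) 2 (volume.restrict Ω) :=
    fun k => ((hφ k).memLp_gradient 2).sub hH
  have herr := (tendsto_integral_norm_mul_norm hH hd hg).const_mul (ν * ε⁻¹)
  rw [mul_zero] at herr
  refine le_of_tendsto_of_tendsto' hlim herr fun k => ?_
  -- S'(φ_k) is an admissible test function because S'(0) = 0; S'(Z) is reached only in the limit.
  have htest := heq _ ((hφ k).comp_smooth hS'c (deriv_smoothAbs_zero hε))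
  -- Here ∇S'(φ_k) = S''(φ_k)∇φ_k and H·∇φ_k = |H|² + H·(∇φ_k - H). The first part contributes
  -- nonnegatively since S'' ≥ 0. The second is at most ε⁻¹|H||∇φ_k - H|, which tends to 0 in L_1.
  have hbound : -(ε⁻¹ * ∫ x in Ω, ‖H x‖ * ‖gradient (φ k) x - H x‖) ≤
      ∫ x in Ω, inner ℝ (H x) (gradient (fun x => S' (φ k x)) x) := by
    rw [← integral_const_mul, ← integral_neg]
    refine integral_mono ((integrable_norm_mul_norm hH (hd k)).const_mul _).neg
      (integrable_inner_of_memLp_two hH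
        (((hφ k).comp_smooth hS'c (deriv_smoothAbs_zero hε)).memLp_gradient 2)) fun x => ?_
    have h0 := deriv_deriv_smoothAbs_nonneg hε (φ k x)
    have h1 := deriv_deriv_smoothAbs_le hε (φ k x)
    simp only
    rw [(hφ k).gradient_comp hS'c, inner_smul_right]
    have h2 : inner ℝ (H x) (gradient (φ k) x) =
        ‖H x‖ ^ 2 + inner ℝ (H x) (gradient (φ k) x - H x) := by
      rw [inner_sub_right, real_inner_self_eq_norm_sq]; ring
    have h3 := neg_le_of_abs_le (abs_real_inner_le_norm (H x) (gradient (φ k) x - H x))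
    rw [← hS'] at h0 h1
    set c := deriv S' (φ k x)
    have h4 : c * (‖H x‖ * ‖gradient (φ k) x - H x‖) ≤
        ε⁻¹ * (‖H x‖ * ‖gradient (φ k) x - H x‖) :=
      mul_le_mul_of_nonneg_right h1 (by positivity)
    have h5 := mul_le_mul_of_nonneg_left h3 h0
    have h6 : 0 ≤ c * ‖H x‖ ^ 2 := by positivity
    rw [h2, mul_add]
    linarith
  have := mul_le_mul_of_nonneg_left hbound hν.le
  linarith

/-- A vector field of nonpositive divergence, tested with a smooth convex function of an element
of `W̊^1_2`. -/
theorem IsTestLimit.integral_inner_deriv_smoothAbs_nonneg [IsFiniteMeasure (volume.restrict Ω)]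
    {Z : E n → ℝ} {H : E n → E n} (h : IsTestLimit Ω Z H)
    (hZ : MemLp Z 2 (volume.restrict Ω)) (hH : MemLp H 2 (volume.restrict Ω))
    {B : E n → E n} (hB : MemLp B 2 (volume.restrict Ω))
    (hdiv : ∀ ψ, IsTestFunction Ω ψ → (∀ x, 0 ≤ ψ x) →
      0 ≤ ∫ x in Ω, inner ℝ (B x) (gradient ψ x)) {ε : ℝ} (hε : 0 < ε) :
    0 ≤ ∫ x in Ω, inner ℝ (B x) (H x) * deriv (smoothAbs ε) (Z x) := by
  obtain ⟨φ, hφ, hae, hg⟩ := h.exists_seq_ae hZ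
  set S' := deriv (smoothAbs ε) with hS'
  have hSc := contDiff_smoothAbs hε
  have hS'c : ContDiff ℝ ∞ S' := contDiff_deriv_smoothAbs hε
  have hS'b : ∀ r, ‖S' r‖ ≤ 1 := abs_deriv_smoothAbs_le hε
  have hBH := integrable_inner_of_memLp_two hB hH
  have hlim : Tendsto (fun k => ∫ x in Ω, inner ℝ (B x) (H x) * S' (φ k x)) atTop
      (𝓝 (∫ x in Ω, inner ℝ (B x) (H x) * S' (Z x))) := by
    refine tendsto_integral_of_dominated_convergence (fun x => ‖inner ℝ (B x) (H x)‖)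
      (fun k => ?_) hBH.norm (fun k => ae_of_all _ fun x => ?_) ?_
    · exact hBH.1.mul (hS'c.continuous.comp (hφ k).contDiff.continuous).aestronglyMeasurable
    · rw [norm_mul]
      exact mul_le_of_le_one_right (norm_nonneg _) (hS'b _)
    · filter_upwards [hae] with x hx
      exact ((hS'c.continuous.tendsto _).comp hx).const_mul _
  have hd : ∀ k, MemLp (fun x => gradient (φ k) x - H x) 2 (volume.restrict Ω) :=
    fun k => ((hφ k).memLp_gradient 2).sub hH
  have herr := hlim.add (tendsto_integral_norm_mul_norm hB hd hg)
  rw [add_zero] at herr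
  refine ge_of_tendsto' herr fun k => ?_
  -- S(φ_k) is a nonnegative test function, and its gradient S'(φ_k)∇φ_k differs from S'(φ_k)H by at
  -- most |∇φ_k - H|.
  have htest := hdiv _ ((hφ k).comp_smooth hSc (smoothAbs_zero hε))
    (fun x => smoothAbs_nonneg _)
  refine htest.trans ?_
  have hi : Integrable (fun x => inner ℝ (B x) (H x) * S' (φ k x)) (volume.restrict Ω) :=
    hBH.mul_bdd (c := 1)
      (hS'c.continuous.comp (hφ k).contDiff.continuous).aestronglyMeasurable
      (ae_of_all _ fun x => hS'b _)
  rw [← integral_add hi (integrable_norm_mul_norm hB (hd k))]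
  refine integral_mono (integrable_inner_of_memLp_two hB
    (((hφ k).comp_smooth hSc (smoothAbs_zero hε)).memLp_gradient 2))
    (hi.add (integrable_norm_mul_norm hB (hd k))) fun x => ?_
  simp only
  rw [(hφ k).gradient_comp hSc, inner_smul_right, ← hS']
  have h2 : inner ℝ (B x) (gradient (φ k) x) =
      inner ℝ (B x) (H x) + inner ℝ (B x) (gradient (φ k) x - H x) := by
    rw [inner_sub_right]; ring
  rw [h2, mul_add, mul_comm]
  refine add_le_add le_rfl ?_
  refine (le_abs_self _).trans ?_
  rw [abs_mul]
  calc |S' (φ k x)| * |inner ℝ (B x) (gradient (φ k) x - H x)|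
      ≤ 1 * |inner ℝ (B x) (gradient (φ k) x - H x)| := by
        gcongr; exact hS'b _
    _ ≤ ‖B x‖ * ‖gradient (φ k) x - H x‖ := by
        rw [one_mul]; exact abs_real_inner_le_norm _ _

/-- Test functions are dense in `L_2(Ω)`, hence approximate its elements in `L_1(Ω)`. -/
theorem exists_isTestFunction_integral_abs_sub_lt (hΩ : IsOpen Ω)
    [IsFiniteMeasure (volume.restrict Ω)] {w : E n → ℝ} (hw : MemLp w 2 (volume.restrict Ω))
    {δ : ℝ} (hδ : 0 < δ) :
    ∃ φ, IsTestFunction Ω φ ∧ ∫ x in Ω, |w x - φ x| < δ := by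
  set μ := volume.restrict Ω with hμ
  let K : Submodule ℝ (Lp ℝ 2 μ) :=
    { carrier := {y | ∃ φ, IsTestFunction Ω φ ∧ y =ᵐ[μ] φ}
      add_mem' := by
        rintro a b ⟨φ, hφ, ha⟩ ⟨ψ, hψ, hb⟩
        exact ⟨_, hφ.add hψ, (Lp.coeFn_add a b).trans (ha.add hb)⟩
      zero_mem' := ⟨_, IsTestFunction.zero Ω, Lp.coeFn_zero ℝ 2 μ⟩
      smul_mem' := by
        rintro c a ⟨φ, hφ, ha⟩
        exact ⟨_, hφ.const_mul c, (Lp.coeFn_smul c a).trans (ha.const_smul c)⟩ }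
  -- Density by duality: an L_2 function orthogonal to all test functions vanishes, by the
  -- fundamental lemma of the calculus of variations.
  have hK : K.topologicalClosure = ⊤ := by
    rw [Submodule.topologicalClosure_eq_top_iff, Submodule.eq_bot_iff]
    intro q hq
    have hz : ∀ᵐ x ∂volume, x ∈ Ω → q x = 0 := by
      refine hΩ.ae_eq_zero_of_integral_contDiff_smul_eq_zero ?_ ?_
      · exact IntegrableOn.locallyIntegrableOn
          (show IntegrableOn q Ω volume from (Lp.memLp q).integrable (by simp))
      · intro g hg hgc hgs
        have hgt : IsTestFunction Ω g := ⟨hg, hgc, hgs⟩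
        have hin := Submodule.inner_right_of_mem_orthogonal
          (show (hgt.memLp 2).toLp g ∈ K from ⟨g, hgt, (hgt.memLp 2).coeFn_toLp⟩) hq
        rw [L2.inner_def] at hin
        rw [← setIntegral_eq_integral_of_forall_compl_eq_zero (s := Ω)
          (fun x hx => by
            rw [image_eq_zero_of_notMem_tsupport fun h => hx (hgs h), zero_smul]), ← hin]
        refine integral_congr_ae ?_
        filter_upwards [(hgt.memLp 2 (μ := μ)).coeFn_toLp] with x hx
        rw [hx]
        simp [mul_comm]
    rw [Lp.eq_zero_iff_ae_eq_zero]
    exact (ae_restrict_iff' hΩ.measurableSet).2 hz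
  have hmem : hw.toLp w ∈ closure (K : Set (Lp ℝ 2 μ)) := by
    rw [← Submodule.topologicalClosure_coe, hK]; trivial
  -- The tolerance turns L_2-closeness into L_1-closeness δ through Cauchy–Schwarz with the function
  -- 1; the +1 keeps the denominator positive when Ω is null.
  obtain ⟨y, ⟨φ, hφ, hyφ⟩, hdist⟩ := Metric.mem_closure_iff.1 hmem
    (δ / ((eLpNorm (fun _ : E n => (1 : ℝ)) 2 μ).toReal + 1)) (by positivity)
  refine ⟨φ, hφ, ?_⟩
  have hy : y = (hφ.memLp 2).toLp φ := Lp.ext (hyφ.trans (hφ.memLp 2).coeFn_toLp.symm)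
  rw [hy, Lp.dist_def] at hdist
  have hcongr : eLpNorm (⇑(hw.toLp w) - ⇑((hφ.memLp 2 (μ := μ)).toLp φ)) 2 μ =
      eLpNorm (fun x => w x - φ x) 2 μ := by
    refine eLpNorm_congr_ae ?_
    filter_upwards [hw.coeFn_toLp, (hφ.memLp 2 (μ := μ)).coeFn_toLp] with x h1 h2
    simp [h1, h2]
  rw [hcongr] at hdist
  have h := integral_norm_mul_norm_le (memLp_const (1 : ℝ) (p := 2) (μ := μ))
    (hw.sub (hφ.memLp 2))
  simp only [norm_one, one_mul, Pi.sub_apply, Real.norm_eq_abs] at h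
  refine h.trans_lt ?_
  rw [lt_div_iff₀ (by positivity)] at hdist
  have h0 : 0 ≤ (eLpNorm (fun x => w x - φ x) 2 μ).toReal := ENNReal.toReal_nonneg
  change _ * (eLpNorm (fun x => w x - φ x) 2 μ).toReal < δ
  nlinarith [ENNReal.toReal_nonneg (a := eLpNorm (fun _ : E n => (1 : ℝ)) 2 μ)]

/-! ### Time averages stay in the closure of the test functions. -/

theorem volume_restrict_cylinder (Ω : Set (E n)) (T : ℝ) :
    volume.restrict (cylinder Ω T) = (volume.restrict Ω).prod (timeMeasure T) := by
  rw [cylinder, Measure.volume_eq_prod, Measure.prod_restrict]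

/-- The values `(φ, ∇φ)` of a function and of its gradient. -/
abbrev Jet (n : ℕ) : Type := WithLp 2 (ℝ × E n)

theorem jet_norm_le (a : ℝ) (c : E n) : ‖(WithLp.toLp 2 (a, c) : Jet n)‖ ≤ ‖a‖ + ‖c‖ := by
  have h := WithLp.prod_norm_sq_eq_of_L2 (WithLp.toLp 2 (a, c) : Jet n)
  refine le_of_sq_le_sq ?_ (by positivity)
  rw [h, WithLp.toLp_fst, WithLp.toLp_snd]
  nlinarith [norm_nonneg a, norm_nonneg c]

theorem norm_fst_le_jet_norm (y : Jet n) : ‖y.fst‖ ≤ ‖y‖ := by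
  have h := WithLp.prod_norm_sq_eq_of_L2 y
  exact le_of_sq_le_sq (by rw [h]; nlinarith [norm_nonneg y.snd]) (norm_nonneg _)

theorem norm_snd_le_jet_norm (y : Jet n) : ‖y.snd‖ ≤ ‖y‖ := by
  have h := WithLp.prod_norm_sq_eq_of_L2 y
  exact le_of_sq_le_sq (by rw [h]; nlinarith [norm_nonneg y.fst]) (norm_nonneg _)

theorem memLp_jet {X : Type*} [MeasurableSpace X] {μ : Measure X} {Z : X → ℝ} {H : X → E n}
    (hZ : MemLp Z 2 μ) (hH : MemLp H 2 μ) :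
    MemLp (fun x => (WithLp.toLp 2 (Z x, H x) : Jet n)) 2 μ := by
  refine (hZ.norm.add hH.norm).mono
    ((WithLp.prod_continuous_toLp 2 ℝ (E n)).comp_aestronglyMeasurable (hZ.1.prodMk hH.1))
    (ae_of_all _ fun x => ?_)
  refine (jet_norm_le _ _).trans ?_
  simp only [Pi.add_apply]
  exact le_abs_self _

/-- The subspace of `L_2(Ω)` formed by `(φ, ∇φ)` for test functions `φ`. -/
def testJets (Ω : Set (E n)) : Submodule ℝ (Lp (Jet n) 2 (volume.restrict Ω)) where
  carrier := {y | ∃ φ, IsTestFunction Ω φ ∧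
    y =ᵐ[volume.restrict Ω] fun x => WithLp.toLp 2 (φ x, gradient φ x)}
  add_mem' := by
    rintro a c ⟨φ, hφ, ha⟩ ⟨ψ, hψ, hc⟩
    refine ⟨_, hφ.add hψ, ?_⟩
    filter_upwards [Lp.coeFn_add a c, ha, hc] with x h1 h2 h3
    rw [h1, Pi.add_apply, h2, h3, hφ.gradient_add hψ]
    rfl
  zero_mem' := by
    refine ⟨_, IsTestFunction.zero Ω, ?_⟩
    filter_upwards [Lp.coeFn_zero (Jet n) 2 (volume.restrict Ω)] with x h1
    rw [h1]
    simp
    rfl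
  smul_mem' := by
    rintro c a ⟨φ, hφ, ha⟩
    refine ⟨_, hφ.const_mul c, ?_⟩
    filter_upwards [Lp.coeFn_smul c a, ha] with x h1 h2
    rw [h1, Pi.smul_apply, h2, hφ.gradient_const_mul]
    rfl

/-- Together with its converse below, this replaces approximating sequences by membership in a
closed subspace of a Hilbert space. Membership can then be checked by pairing with the orthogonal
complement. -/
theorem IsTestLimit.mem_closure_testJets [IsFiniteMeasure (volume.restrict Ω)] {Z : E n → ℝ}
    {H : E n → E n} (h : IsTestLimit Ω Z H) (hZ : MemLp Z 2 (volume.restrict Ω))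
    (hH : MemLp H 2 (volume.restrict Ω)) :
    (memLp_jet hZ hH).toLp _ ∈ (testJets Ω).topologicalClosure := by
  obtain ⟨φ, hφ, h1, h2⟩ := h
  rw [← SetLike.mem_coe, Submodule.topologicalClosure_coe]
  have hm : ∀ k, MemLp (fun x => (WithLp.toLp 2 (φ k x, gradient (φ k) x) : Jet n)) 2
      (volume.restrict Ω) := fun k => memLp_jet ((hφ k).memLp 2) ((hφ k).memLp_gradient 2)
  refine mem_closure_of_tendsto (f := fun k => (hm k).toLp _) (b := atTop) ?_
    (Eventually.of_forall fun k => ⟨φ k, hφ k, (hm k).coeFn_toLp⟩)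
  rw [tendsto_iff_edist_tendsto_0]
  have hsum := h1.add h2
  rw [add_zero] at hsum
  refine tendsto_of_tendsto_of_tendsto_of_le_of_le tendsto_const_nhds hsum
    (fun _ => zero_le) fun k => ?_
  rw [Lp.edist_toLp_toLp]
  have hZd := ((hφ k).memLp 2).sub hZ
  have hHd := ((hφ k).memLp_gradient 2).sub hH
  calc _ ≤ eLpNorm ((fun x => ‖φ k x - Z x‖) + fun x => ‖gradient (φ k) x - H x‖) 2
          (volume.restrict Ω) := by
        refine eLpNorm_mono_real fun x => ?_
        exact jet_norm_le (φ k x - Z x) (gradient (φ k) x - H x)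
    _ ≤ eLpNorm (fun x => ‖φ k x - Z x‖) 2 (volume.restrict Ω) +
          eLpNorm (fun x => ‖gradient (φ k) x - H x‖) 2 (volume.restrict Ω) :=
        eLpNorm_add_le hZd.1.norm hHd.1.norm (by simp)
    _ = _ := by rw [eLpNorm_norm, eLpNorm_norm]

theorem isTestLimit_of_mem_closure_testJets {Z : E n → ℝ}
    {H : E n → E n} (hZ : MemLp Z 2 (volume.restrict Ω)) (hH : MemLp H 2 (volume.restrict Ω))
    (h : (memLp_jet hZ hH).toLp _ ∈ (testJets Ω).topologicalClosure) : IsTestLimit Ω Z H := by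
  rw [← SetLike.mem_coe, Submodule.topologicalClosure_coe, mem_closure_iff_seq_limit] at h
  obtain ⟨y, hy, hlim⟩ := h
  choose φ hφ hyφ using hy
  rw [tendsto_iff_edist_tendsto_0] at hlim
  have hpt : ∀ k, ∀ᵐ x ∂(volume.restrict Ω), (y k - (memLp_jet hZ hH).toLp _ :
      Lp (Jet n) 2 (volume.restrict Ω)) x =
      WithLp.toLp 2 (φ k x - Z x, gradient (φ k) x - H x) := by
    intro k
    filter_upwards [Lp.coeFn_sub (y k) ((memLp_jet hZ hH).toLp _), hyφ k,
      (memLp_jet hZ hH).coeFn_toLp] with x h1 h2 h3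
    rw [h1, Pi.sub_apply, h2, h3]
    rfl
  have hed : ∀ k, edist (y k) ((memLp_jet hZ hH).toLp _) =
      eLpNorm (y k - (memLp_jet hZ hH).toLp _ : Lp (Jet n) 2 (volume.restrict Ω)) 2
        (volume.restrict Ω) := by
    intro k
    rw [Lp.edist_def]
    exact eLpNorm_congr_ae (Lp.coeFn_sub _ _).symm
  refine ⟨φ, hφ, ?_, ?_⟩
  · refine tendsto_of_tendsto_of_tendsto_of_le_of_le tendsto_const_nhds hlim
      (fun _ => zero_le) fun k => ?_
    rw [hed]
    refine eLpNorm_mono_ae ?_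
    filter_upwards [hpt k] with x hx
    rw [hx]
    exact norm_fst_le_jet_norm (WithLp.toLp 2 (φ k x - Z x, gradient (φ k) x - H x))
  · refine tendsto_of_tendsto_of_tendsto_of_le_of_le tendsto_const_nhds hlim
      (fun _ => zero_le) fun k => ?_
    rw [hed]
    refine eLpNorm_mono_ae ?_
    filter_upwards [hpt k] with x hx
    rw [hx]
    exact norm_snd_le_jet_norm (WithLp.toLp 2 (φ k x - Z x, gradient (φ k) x - H x))

theorem memLp_two_slice_ae {X V : Type*} [MeasurableSpace X] {μ : Measure X} [SFinite μ]
    [NormedAddCommGroup V] {T : ℝ} {F : X × ℝ → V}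
    (hF : MemLp F 2 (μ.prod (timeMeasure T))) :
    ∀ᵐ s ∂(timeMeasure T), MemLp (fun x => F (x, s)) 2 μ := by
  have h1 := (memLp_two_iff_integrable_sq_norm hF.1).1 hF
  filter_upwards [h1.prod_left_ae, hF.1.prodMk_right] with s hs hs'
  exact (memLp_two_iff_integrable_sq_norm hs').2 hs

/-- Time mollification preserves the space `W̊^1_2(Ω)`. -/
theorem isTestLimit_timeMollify [IsFiniteMeasure (volume.restrict Ω)] (T : ℝ) {ρ : ℝ → ℝ}
    (hρ : Continuous ρ) (hc : HasCompactSupport ρ) {w : E n × ℝ → ℝ} {G : E n × ℝ → E n}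
    (hw : StronglyMeasurable w) (hG : StronglyMeasurable G)
    (hw2 : MemLp w 2 ((volume.restrict Ω).prod (timeMeasure T)))
    (hG2 : MemLp G 2 ((volume.restrict Ω).prod (timeMeasure T)))
    (hlim : ∀ᵐ s ∂(timeMeasure T), IsTestLimit Ω (fun x => w (x, s)) (fun x => G (x, s)))
    (t : ℝ) : IsTestLimit Ω (fun x => timeMollify T ρ w x t) (fun x => timeMollify T ρ G x t) := by
  set μ := volume.restrict Ω with hμ
  have hwt := memLp_two_timeMollify_slice T hρ hc hw hw2 t
  have hGt := memLp_two_timeMollify_slice T hρ hc hG hG2 t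
  refine isTestLimit_of_mem_closure_testJets hwt hGt ?_
  -- It suffices to pair with each q orthogonal to the test jets. By Fubini the pairing is an
  -- integral over s of ρ(t - s)⟨q, (w, G)(s)⟩, and the inner product vanishes for almost every s.
  -- No measurable choice of approximating sequences in s is needed.
  rw [← Submodule.orthogonal_orthogonal_eq_closure, Submodule.mem_orthogonal]
  intro q hq
  set Y : E n × ℝ → Jet n := fun z => WithLp.toLp 2 (w z, G z) with hY
  have hY2 : MemLp Y 2 (μ.prod (timeMeasure T)) := memLp_jet hw2 hG2
  have hYi : Integrable Y (μ.prod (timeMeasure T)) := hY2.integrable (by simp)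
  have hqY : Integrable (fun z : E n × ℝ => inner ℝ (q z.1) (Y z)) (μ.prod (timeMeasure T)) :=
    integrable_inner_of_memLp_two ((Lp.memLp q).comp_fst (timeMeasure T)) hY2
  have hpair : ∀ᵐ x ∂μ, (WithLp.toLp 2 (timeMollify T ρ w x t, timeMollify T ρ G x t) : Jet n) =
      timeMollify T ρ Y x t := by
    filter_upwards [ae_integrable_timeMollify_integrand T hρ hc hYi] with x hx
    have h1 := (WithLp.fstL 2 ℝ ℝ (E n)).integral_comp_comm (hx t)
    have h2 := (WithLp.sndL 2 ℝ ℝ (E n)).integral_comp_comm (hx t)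
    refine (WithLp.ofLp_injective 2) (Prod.ext ?_ ?_)
    · exact h1
    · exact h2
  rw [L2.inner_def]
  have e1 : ∫ x, inner ℝ (q x) ((memLp_jet hwt hGt).toLp _ x) ∂μ =
      ∫ x, inner ℝ (q x) (timeMollify T ρ Y x t) ∂μ := by
    refine integral_congr_ae ?_
    filter_upwards [(memLp_jet hwt hGt).coeFn_toLp, hpair] with x h1 h2
    rw [h1, h2]
  rw [e1, integral_inner_timeMollify T hρ hc hYi t hqY]
  obtain ⟨C, hC⟩ := exists_bound_of_hasCompactSupport hρ hc
  have hi : Integrable (fun z : E n × ℝ => ρ (t - z.2) * inner ℝ (q z.1) (Y z))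
      (μ.prod (timeMeasure T)) :=
    hqY.bdd_mul (c := C) (Continuous.aestronglyMeasurable (by fun_prop))
      (ae_of_all _ fun s => hC _)
  rw [integral_prod_symm _ hi]
  refine integral_eq_zero_of_ae ?_
  filter_upwards [hlim, memLp_two_slice_ae hw2, memLp_two_slice_ae hG2] with s h1 h2 h3
  have hmem := h1.mem_closure_testJets h2 h3
  rw [← Submodule.orthogonal_orthogonal_eq_closure] at hmem
  have h0 := Submodule.inner_right_of_mem_orthogonal hq hmem
  rw [L2.inner_def] at h0
  simp only [Pi.zero_apply]
  rw [integral_const_mul]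
  refine mul_eq_zero_of_right _ (Eq.trans ?_ h0)
  refine integral_congr_ae ?_
  filter_upwards [(memLp_jet h2 h3).coeFn_toLp] with x hx
  rw [hx]

/-! ### Product test functions and the sign of the divergence on time slices. -/

/-- The space-time test function `(x, s) ↦ ρ (t - s) ψ x`. -/
def kernelTest (ρ : ℝ → ℝ) (t : ℝ) (ψ : E n → ℝ) (z : E n × ℝ) : ℝ := ρ (t - z.2) * ψ z.1

theorem isTestFunction_kernelTest {ρ : ℝ → ℝ} {J I : Set ℝ} (hρ : IsTestFunction J ρ) {t : ℝ}
    (hJ : ∀ s, t - s ∈ J → s ∈ I) {ψ : E n → ℝ} (hψ : IsTestFunction Ω ψ) :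
    IsTestFunction (Ω ×ˢ I) (kernelTest ρ t ψ) := by
  have hsub : tsupport (kernelTest ρ t ψ) ⊆ tsupport ψ ×ˢ ((fun s => t - s) ⁻¹' tsupport ρ) := by
    refine closure_minimal ?_ ((isClosed_tsupport ψ).prod
      ((isClosed_tsupport ρ).preimage (by fun_prop)))
    intro z hz
    rw [Function.mem_support, kernelTest] at hz
    exact ⟨subset_tsupport _ (right_ne_zero_of_mul hz), subset_tsupport ρ (left_ne_zero_of_mul hz)⟩
  refine ⟨?_, ?_, hsub.trans (prod_mono hψ.tsupport_subset
    fun s hs => hJ s (hρ.tsupport_subset hs))⟩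
  · exact (hρ.contDiff.comp (contDiff_const.sub contDiff_snd)).mul (hψ.contDiff.comp contDiff_fst)
  · refine (IsCompact.prod hψ.hasCompactSupport ?_).of_isClosed_subset (isClosed_tsupport _) hsub
    exact (Homeomorph.subLeft t).isCompact_preimage.2 hρ.hasCompactSupport

theorem gradX_kernelTest (ρ : ℝ → ℝ) (t : ℝ) {ψ : E n → ℝ} (hψ : IsTestFunction Ω ψ)
    (z : E n × ℝ) : gradX (kernelTest ρ t ψ) z = ρ (t - z.2) • gradient ψ z.1 :=
  hψ.gradient_const_mul (ρ (t - z.2)) z.1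

theorem derivT_kernelTest {ρ : ℝ → ℝ} (hρ : Differentiable ℝ ρ) (t : ℝ) (ψ : E n → ℝ)
    (z : E n × ℝ) : derivT (kernelTest ρ t ψ) z = -(deriv ρ (t - z.2) * ψ z.1) := by
  have h := ((hρ (t - z.2)).hasDerivAt.comp_const_sub t z.2).mul_const (ψ z.1)
  have : derivT (kernelTest ρ t ψ) z = -deriv ρ (t - z.2) * ψ z.1 := h.deriv
  rw [this, neg_mul]

/-- A fixed nonnegative test function sees a nonpositive divergence at almost every time. -/
theorem DivNonpos.slice_nonneg_ae [IsFiniteMeasure (volume.restrict Ω)] {T : ℝ}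
    {b : E n × ℝ → E n} (hdiv : DivNonpos Ω T b) (hbm : StronglyMeasurable b)
    (hb : MemLp b 2 ((volume.restrict Ω).prod (timeMeasure T))) {ψ : E n → ℝ}
    (hψ : IsTestFunction Ω ψ) (hψ0 : ∀ x, 0 ≤ ψ x) :
    ∀ᵐ s ∂(timeMeasure T), 0 ≤ ∫ x in Ω, inner ℝ (b (x, s)) (gradient ψ x) := by
  set μ := volume.restrict Ω with hμ
  set F : E n × ℝ → ℝ := fun z => inner ℝ (b z) (gradient ψ z.1) with hF
  have hgs : StronglyMeasurable (gradient ψ) := hψ.contDiff_gradient.continuous.stronglyMeasurable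
  have hFm : StronglyMeasurable F :=
    hbm.inner (hgs.comp_measurable measurable_fst)
  have hFi : Integrable F (μ.prod (timeMeasure T)) :=
    integrable_inner_of_memLp_two hb ((hψ.memLp_gradient 2).comp_fst (timeMeasure T))
  have hmi : ∀ m, Integrable (fun z : E n × ℝ => timeMollify T (timeKernel m) F z.1 z.2)
      (μ.prod (timeMeasure T)) := fun m =>
    integrable_timeMollify T (isTestFunction_timeKernel m).contDiff.continuous
      (isTestFunction_timeKernel m).hasCompactSupport hFm hFi
  have hlim := tendsto_integral_norm_timeMollify_sub T hFm hFi
  -- β m is the mollification of s ↦ ∫ b(x,s)·∇ψ(x) dx. It is nonnegative at a given time once m is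
  -- large, and along a subsequence it converges almost everywhere to that function.
  set β : ℕ → ℝ → ℝ := fun m t => ∫ x, timeMollify T (timeKernel m) F x t ∂μ with hβ
  have hβi : ∀ m, Integrable (β m) (timeMeasure T) := fun m => (hmi m).integral_prod_right
  have hBi : Integrable (fun s => ∫ x, F (x, s) ∂μ) (timeMeasure T) := hFi.integral_prod_right
  have hL1 : Tendsto (fun m => eLpNorm (β m - fun s => ∫ x, F (x, s) ∂μ) 1 (timeMeasure T))
      atTop (𝓝 0) := by
    have hbd : ∀ m, eLpNorm (β m - fun s => ∫ x, F (x, s) ∂μ) 1 (timeMeasure T) ≤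
        ENNReal.ofReal (∫ z, ‖timeMollify T (timeKernel m) F z.1 z.2 - F z‖
          ∂(μ.prod (timeMeasure T))) := by
      intro m
      have hd : Integrable (fun z : E n × ℝ => timeMollify T (timeKernel m) F z.1 z.2 - F z)
          (μ.prod (timeMeasure T)) := (hmi m).sub hFi
      rw [eLpNorm_one_eq_lintegral_enorm,
        ofReal_integral_norm_eq_lintegral_enorm hd, lintegral_prod_symm _ hd.1.enorm]
      refine lintegral_mono_ae ?_
      filter_upwards [(hmi m).prod_left_ae, hFi.prod_left_ae] with s h1 h2
      simp only [Pi.sub_apply, hβ]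
      rw [← integral_sub h1 h2]
      exact enorm_integral_le_lintegral_enorm _
    have h0 := (ENNReal.continuous_ofReal.tendsto 0).comp hlim
    rw [ENNReal.ofReal_zero] at h0
    exact tendsto_of_tendsto_of_tendsto_of_le_of_le tendsto_const_nhds h0
      (fun _ => zero_le) hbd
  have hmeas := tendstoInMeasure_of_tendsto_eLpNorm (p := 1) (by simp)
    (fun m => (hβi m).1) hBi.1 hL1
  obtain ⟨ns, hns, hae⟩ := hmeas.exists_seq_tendsto_ae
  filter_upwards [hae, ae_restrict_mem measurableSet_Ioo] with t ht htT
  refine ge_of_tendsto ht ?_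
  -- Once the kernel is supported in (0,t), the product test function is supported in times inside
  -- (0,t), away from both ends of (0,T), so the hypothesis on div b applies to it.
  filter_upwards [hns.tendsto_atTop.eventually (eventually_tsupport_timeKernel_subset htT.1)]
    with k hk
  have hρ := isTestFunction_timeKernel (ns k)
  have htest : IsTestFunction (cylinder Ω T) (kernelTest (timeKernel (ns k)) t ψ) :=
    isTestFunction_kernelTest (J := Ioo 0 t) (I := Ioo 0 T) ⟨hρ.contDiff, hρ.hasCompactSupport, hk⟩
      (fun s hs => ⟨by linarith [hs.2], by linarith [hs.1, htT.2]⟩) hψ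
  have hpos := hdiv _ htest fun z => mul_nonneg (timeKernel_nonneg _ _) (hψ0 _)
  rw [volume_restrict_cylinder] at hpos
  have hFub := integral_inner_timeMollify (μ := μ) T hρ.contDiff.continuous hρ.hasCompactSupport
    hFi t (p := fun _ => (1 : ℝ)) (by simpa using hFi)
  have hone : β (ns k) t = ∫ x, inner ℝ (1 : ℝ) (timeMollify T (timeKernel (ns k)) F x t) ∂μ := by
    simp [hβ]
  rw [hone, hFub]
  refine hpos.trans_eq (integral_congr_ae (ae_of_all _ fun z => ?_))
  simp only
  rw [gradX_kernelTest _ _ hψ, inner_smul_right]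
  simp [hF]

/-- The spatial divergence is nonpositive at almost every time. -/
theorem DivNonpos.ae_slice [IsFiniteMeasure (volume.restrict Ω)] {T : ℝ}
    {b : E n × ℝ → E n} (hdiv : DivNonpos Ω T b) (hbm : StronglyMeasurable b)
    (hb : MemLp b 2 ((volume.restrict Ω).prod (timeMeasure T))) :
    ∀ᵐ s ∂(timeMeasure T), ∀ ψ, IsTestFunction Ω ψ → (∀ x, 0 ≤ ψ x) →
      0 ≤ ∫ x in Ω, inner ℝ (b (x, s)) (gradient ψ x) := by
  set μ := volume.restrict Ω with hμ
  let ι := {ψ : E n → ℝ // IsTestFunction Ω ψ ∧ ∀ x, 0 ≤ ψ x}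
  let J : ι → Lp (E n) 2 μ := fun ψ => (ψ.2.1.memLp_gradient 2).toLp _
  have : Fact ((2 : ℝ≥0∞) ≠ ⊤) := ⟨by simp⟩
  -- The null set of times depends on ψ. Separability of L_2 leaves countably many gradients to
  -- treat, and the inequality is closed under L_2-limits of gradients.
  obtain ⟨D, hDsub, hDc, hDd⟩ :=
    (TopologicalSpace.IsSeparable.of_separableSpace (range J)).exists_countable_dense_subset
  have hchoose : ∀ d : D, ∃ ψ : ι, J ψ = d := fun d => hDsub d.2
  choose Ψ hΨ using hchoose
  have := hDc.to_subtype
  have hall : ∀ᵐ s ∂(timeMeasure T), ∀ d : D,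
      0 ≤ ∫ x in Ω, inner ℝ (b (x, s)) (gradient (Ψ d).1 x) :=
    ae_all_iff.2 fun d => hdiv.slice_nonneg_ae hbm hb (Ψ d).2.1 (Ψ d).2.2
  filter_upwards [hall, memLp_two_slice_ae hb] with s hs hbs ψ hψ hψ0
  have hval : ∀ ψ' : ι, inner ℝ (hbs.toLp _) (J ψ') =
      ∫ x in Ω, inner ℝ (b (x, s)) (gradient ψ'.1 x) := by
    intro ψ'
    rw [L2.inner_def]
    refine integral_congr_ae ?_
    filter_upwards [hbs.coeFn_toLp, (ψ'.2.1.memLp_gradient (μ := μ) 2).coeFn_toLp] with x h1 h2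
    rw [h1, h2]
  have hclosed : IsClosed {y : Lp (E n) 2 μ | 0 ≤ inner ℝ (hbs.toLp _) y} :=
    isClosed_le continuous_const (continuous_const.inner continuous_id)
  have hD : D ⊆ {y : Lp (E n) 2 μ | 0 ≤ inner ℝ (hbs.toLp _) y} := by
    intro d hd
    have := hs ⟨d, hd⟩
    rw [← hval, hΨ] at this
    exact this
  have hmem := hclosed.closure_subset_iff.2 hD (hDd ⟨⟨ψ, hψ, hψ0⟩, rfl⟩)
  rw [← hval ⟨ψ, hψ, hψ0⟩]
  exact hmem

/-! ### The mollified heat equation and its L_1 estimates. -/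

/-- `w` is a weak solution of the heat equation `∂_t w - νΔw = g` with zero boundary values,
initial value `w₀` and spatial gradient `G`, tested with `ρ (t - s) ψ(x)`. -/
structure IsHeatSolution (Ω : Set (E n)) (T ν : ℝ) (w₀ : E n → ℝ) (w : E n × ℝ → ℝ)
    (G : E n × ℝ → E n) (g : E n × ℝ → ℝ) : Prop where
  stronglyMeasurable : StronglyMeasurable w
  stronglyMeasurable_grad : StronglyMeasurable G
  stronglyMeasurable_rhs : StronglyMeasurable g
  memLp : MemLp w 2 ((volume.restrict Ω).prod (timeMeasure T))
  memLp_grad : MemLp G 2 ((volume.restrict Ω).prod (timeMeasure T))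
  integrable_rhs : Integrable g ((volume.restrict Ω).prod (timeMeasure T))
  integrable_init : Integrable w₀ (volume.restrict Ω)
  isTestLimit : ∀ᵐ s ∂(timeMeasure T), IsTestLimit Ω (fun x => w (x, s)) (fun x => G (x, s))
  weak_eq : ∀ ρ, IsTestFunction (Ioi 0) ρ → ∀ t ≤ T, ∀ ψ, IsTestFunction Ω ψ →
    (∫ z, deriv ρ (t - z.2) * (ψ z.1 * w z) ∂((volume.restrict Ω).prod (timeMeasure T))) +
      ν * (∫ z, ρ (t - z.2) * inner ℝ (gradient ψ z.1) (G z)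
        ∂((volume.restrict Ω).prod (timeMeasure T))) =
    ρ t * (∫ x in Ω, w₀ x * ψ x) +
      ∫ z, ρ (t - z.2) * (ψ z.1 * g z) ∂((volume.restrict Ω).prod (timeMeasure T))

theorem real_inner_eq_mul (a c : ℝ) : inner ℝ a c = a * c := by
  rw [real_inner_comm]
  rfl

theorem isTestFunction_deriv {ρ : ℝ → ℝ} {I : Set ℝ} (hρ : IsTestFunction I ρ) :
    IsTestFunction I (deriv ρ) where
  contDiff := (contDiff_infty_iff_deriv.1 hρ.contDiff).2
  hasCompactSupport := hρ.hasCompactSupport.deriv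
  tsupport_subset :=
    (closure_minimal support_deriv_subset (isClosed_tsupport _)).trans hρ.tsupport_subset

namespace IsHeatSolution

variable [IsFiniteMeasure (volume.restrict Ω)] {T ν : ℝ} {w₀ : E n → ℝ} {w : E n × ℝ → ℝ}
  {G : E n × ℝ → E n} {g : E n × ℝ → ℝ}

theorem integrable (h : IsHeatSolution Ω T ν w₀ w G g) :
    Integrable w ((volume.restrict Ω).prod (timeMeasure T)) := h.memLp.integrable (by simp)

/-- The mollified equation at a fixed time. -/
theorem slice_eq (h : IsHeatSolution Ω T ν w₀ w G g) {ρ : ℝ → ℝ}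
    (hρ : IsTestFunction (Ioi 0) ρ) {t : ℝ} (ht : t ≤ T) {ψ : E n → ℝ} (hψ : IsTestFunction Ω ψ) :
    (∫ x in Ω, (timeMollify T (deriv ρ) w x t - ρ t * w₀ x - timeMollify T ρ g x t) * ψ x) +
      ν * ∫ x in Ω, inner ℝ (timeMollify T ρ G x t) (gradient ψ x) = 0 := by
  set μ := volume.restrict Ω with hμ
  have hρ' := isTestFunction_deriv hρ
  obtain ⟨C, hC⟩ := hψ.exists_bound
  have hψm : AEStronglyMeasurable (fun z : E n × ℝ => ψ z.1) (μ.prod (timeMeasure T)) :=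
    (hψ.contDiff.continuous.comp continuous_fst).aestronglyMeasurable
  have hbw : Integrable (fun z : E n × ℝ => inner ℝ (ψ z.1) (w z)) (μ.prod (timeMeasure T)) := by
    simp only [real_inner_eq_mul]
    exact h.integrable.bdd_mul hψm (ae_of_all _ fun z => hC z.1)
  have hbg : Integrable (fun z : E n × ℝ => inner ℝ (ψ z.1) (g z)) (μ.prod (timeMeasure T)) := by
    simp only [real_inner_eq_mul]
    exact h.integrable_rhs.bdd_mul hψm (ae_of_all _ fun z => hC z.1)
  have hbG : Integrable (fun z : E n × ℝ => inner ℝ (gradient ψ z.1) (G z))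
      (μ.prod (timeMeasure T)) :=
    integrable_inner_of_memLp_two ((hψ.memLp_gradient 2).comp_fst _) h.memLp_grad
  have e1 := integral_inner_timeMollify T hρ'.contDiff.continuous hρ'.hasCompactSupport
    h.integrable t hbw
  have e2 := integral_inner_timeMollify T hρ.contDiff.continuous hρ.hasCompactSupport
    h.integrable_rhs t hbg
  have e3 := integral_inner_timeMollify T hρ.contDiff.continuous hρ.hasCompactSupport
    (h.memLp_grad.integrable (by simp)) t hbG
  simp only [real_inner_eq_mul] at e1 e2
  have heq := h.weak_eq ρ hρ t ht ψ hψ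
  rw [← e1, ← e2, ← e3] at heq
  have hψm' : AEStronglyMeasurable ψ μ := hψ.contDiff.continuous.aestronglyMeasurable
  have i1 : Integrable (fun x => ψ x * timeMollify T (deriv ρ) w x t) μ :=
    (integrable_timeMollify_slice T hρ'.contDiff.continuous hρ'.hasCompactSupport
      h.stronglyMeasurable h.integrable t).bdd_mul hψm' (ae_of_all _ hC)
  have i2 : Integrable (fun x => ψ x * timeMollify T ρ g x t) μ :=
    (integrable_timeMollify_slice T hρ.contDiff.continuous hρ.hasCompactSupport
      h.stronglyMeasurable_rhs h.integrable_rhs t).bdd_mul hψm' (ae_of_all _ hC)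
  have i3 : Integrable (fun x => w₀ x * ψ x) μ :=
    h.integrable_init.mul_bdd hψm' (ae_of_all _ hC)
  have e4 : ∫ x, (timeMollify T (deriv ρ) w x t - ρ t * w₀ x - timeMollify T ρ g x t) * ψ x ∂μ =
      (∫ x, ψ x * timeMollify T (deriv ρ) w x t ∂μ) - ρ t * (∫ x, w₀ x * ψ x ∂μ) -
        ∫ x, ψ x * timeMollify T ρ g x t ∂μ := by
    have i4 : Integrable (fun x => ψ x * timeMollify T (deriv ρ) w x t - ρ t * (w₀ x * ψ x)) μ :=
      i1.sub (i3.const_mul _)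
    rw [← integral_const_mul, ← integral_sub i1 (i3.const_mul _), ← integral_sub i4 i2]
    refine integral_congr_ae (ae_of_all _ fun x => ?_)
    ring
  have e5 : ∫ x, inner ℝ (timeMollify T ρ G x t) (gradient ψ x) ∂μ =
      ∫ x, inner ℝ (gradient ψ x) (timeMollify T ρ G x t) ∂μ := by
    simp_rw [real_inner_comm]
  rw [e4, e5]
  linarith

/-- At fixed t the mollified equation is stationary with integrable residual, so it can be tested
with S' of the mollified solution; the diffusion term is dropped by its sign. -/
theorem integral_deriv_smoothAbs_le (h : IsHeatSolution Ω T ν w₀ w G g) (hν : 0 < ν) {ρ : ℝ → ℝ}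
    (hρ : IsTestFunction (Ioi 0) ρ) {t : ℝ} (ht : t ≤ T) {ε : ℝ} (hε : 0 < ε) :
    ∫ x in Ω, timeMollify T (deriv ρ) w x t * deriv (smoothAbs ε) (timeMollify T ρ w x t) ≤
      ∫ x in Ω, (ρ t * w₀ x + timeMollify T ρ g x t) *
        deriv (smoothAbs ε) (timeMollify T ρ w x t) := by
  have hρ' := isTestFunction_deriv hρ
  have i1 := integrable_timeMollify_slice T hρ'.contDiff.continuous hρ'.hasCompactSupport
    h.stronglyMeasurable h.integrable t
  have i2 := integrable_timeMollify_slice T hρ.contDiff.continuous hρ.hasCompactSupport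
    h.stronglyMeasurable_rhs h.integrable_rhs t
  have i3 : Integrable (fun x => ρ t * w₀ x) (volume.restrict Ω) := h.integrable_init.const_mul _
  have hSm : AEStronglyMeasurable (fun x => deriv (smoothAbs ε) (timeMollify T ρ w x t))
      (volume.restrict Ω) :=
    ((contDiff_deriv_smoothAbs hε).continuous.comp_stronglyMeasurable
      (stronglyMeasurable_timeMollify_slice T hρ.contDiff.continuous h.stronglyMeasurable
        t)).aestronglyMeasurable
  have hSb : ∀ᵐ x ∂(volume.restrict Ω),
      ‖deriv (smoothAbs ε) (timeMollify T ρ w x t)‖ ≤ 1 :=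
    ae_of_all _ fun x => abs_deriv_smoothAbs_le hε _
  have key := (isTestLimit_timeMollify T hρ.contDiff.continuous hρ.hasCompactSupport
    h.stronglyMeasurable h.stronglyMeasurable_grad h.memLp h.memLp_grad h.isTestLimit
    t).integral_mul_deriv_smoothAbs_nonpos
    (memLp_two_timeMollify_slice T hρ.contDiff.continuous hρ.hasCompactSupport
      h.stronglyMeasurable h.memLp t)
    (memLp_two_timeMollify_slice T hρ.contDiff.continuous hρ.hasCompactSupport
      h.stronglyMeasurable_grad h.memLp_grad t) ((i1.sub i3).sub i2) hν
    (fun ψ hψ => h.slice_eq hρ ht hψ) hε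
  have k2 : Integrable (fun x => (ρ t * w₀ x + timeMollify T ρ g x t) *
      deriv (smoothAbs ε) (timeMollify T ρ w x t)) (volume.restrict Ω) :=
    (i3.add i2).mul_bdd hSm hSb
  rw [← sub_nonpos, ← integral_sub (i1.mul_bdd hSm hSb) k2]
  refine le_trans (le_of_eq (integral_congr_ae (ae_of_all _ fun x => ?_))) key
  simp only [Pi.sub_apply]
  ring

end IsHeatSolution

theorem restrict_Ioc_le_timeMeasure {T t₁ t₂ : ℝ} (h₁ : 0 ≤ t₁) (h₂ : t₂ ≤ T) :
    volume.restrict (Ioc t₁ t₂) ≤ timeMeasure T := by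
  rw [timeMeasure, Measure.restrict_congr_set (Ioo_ae_eq_Ioc (a := (0 : ℝ)) (b := T))]
  exact Measure.restrict_mono (Ioc_subset_Ioc h₁ h₂) le_rfl

theorem prod_restrict_Ioc_le {X : Type*} [MeasurableSpace X] (μ : Measure X) [SFinite μ]
    {T t₁ t₂ : ℝ} (h₁ : 0 ≤ t₁) (h₂ : t₂ ≤ T) :
    μ.prod (volume.restrict (Ioc t₁ t₂)) ≤ μ.prod (timeMeasure T) :=
  Measure.prod_mono le_rfl (restrict_Ioc_le_timeMeasure h₁ h₂)

namespace IsHeatSolution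

variable [IsFiniteMeasure (volume.restrict Ω)] {T ν : ℝ} {w₀ : E n → ℝ} {w : E n × ℝ → ℝ}
  {G : E n × ℝ → E n} {g : E n × ℝ → ℝ}

theorem integrable_smoothAbs_slice (h : IsHeatSolution Ω T ν w₀ w G g) {ρ : ℝ → ℝ}
    (hρ : IsTestFunction (Ioi 0) ρ) (t : ℝ) {ε : ℝ} (hε : 0 < ε) :
    Integrable (fun x => smoothAbs ε (timeMollify T ρ w x t)) (volume.restrict Ω) :=
  integrable_smoothAbs_comp hε (integrable_timeMollify_slice T hρ.contDiff.continuous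
    hρ.hasCompactSupport h.stronglyMeasurable h.integrable t)

/-- The entropy inequality for the mollified solution. -/
theorem integral_smoothAbs_le (h : IsHeatSolution Ω T ν w₀ w G g) (hν : 0 < ν) {ρ : ℝ → ℝ}
    (hρ : IsTestFunction (Ioi 0) ρ) {t₁ t₂ : ℝ} (h₁ : 0 ≤ t₁) (h₁₂ : t₁ ≤ t₂) (h₂ : t₂ ≤ T)
    {ε : ℝ} (hε : 0 < ε) :
    ∫ x in Ω, smoothAbs ε (timeMollify T ρ w x t₂) ≤
      (∫ x in Ω, smoothAbs ε (timeMollify T ρ w x t₁)) +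
      ∫ z, (ρ z.2 * w₀ z.1 + timeMollify T ρ g z.1 z.2) *
        deriv (smoothAbs ε) (timeMollify T ρ w z.1 z.2)
        ∂((volume.restrict Ω).prod (volume.restrict (Ioc t₁ t₂))) := by
  set μ := volume.restrict Ω with hμ
  set τ := volume.restrict (Ioc t₁ t₂) with hτ
  have hρ' := isTestFunction_deriv hρ
  have hle : μ.prod τ ≤ μ.prod (timeMeasure T) := prod_restrict_Ioc_le μ h₁ h₂
  have j1 : Integrable (fun z : E n × ℝ => timeMollify T (deriv ρ) w z.1 z.2) (μ.prod τ) :=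
    (integrable_timeMollify T hρ'.contDiff.continuous hρ'.hasCompactSupport
      h.stronglyMeasurable h.integrable).mono_measure hle
  have j2 : Integrable (fun z : E n × ℝ => timeMollify T ρ g z.1 z.2) (μ.prod τ) :=
    (integrable_timeMollify T hρ.contDiff.continuous hρ.hasCompactSupport
      h.stronglyMeasurable_rhs h.integrable_rhs).mono_measure hle
  have j3 : Integrable (fun z : E n × ℝ => ρ z.2 * w₀ z.1) (μ.prod τ) := by
    obtain ⟨C, hC⟩ := exists_bound_of_hasCompactSupport hρ.contDiff.continuous
      hρ.hasCompactSupport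
    exact (h.integrable_init.comp_fst τ).bdd_mul
      (hρ.contDiff.continuous.comp continuous_snd).aestronglyMeasurable
      (ae_of_all _ fun z => hC z.2)
  have hSm : AEStronglyMeasurable
      (fun z : E n × ℝ => deriv (smoothAbs ε) (timeMollify T ρ w z.1 z.2)) (μ.prod τ) :=
    ((contDiff_deriv_smoothAbs hε).continuous.comp_stronglyMeasurable
      (stronglyMeasurable_timeMollify T hρ.contDiff.continuous
        h.stronglyMeasurable)).aestronglyMeasurable
  have hSb : ∀ᵐ z ∂(μ.prod τ), ‖deriv (smoothAbs ε) (timeMollify T ρ w z.1 z.2)‖ ≤ 1 :=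
    ae_of_all _ fun x => abs_deriv_smoothAbs_le hε _
  have k1 := j1.mul_bdd hSm hSb
  have k2 : Integrable (fun z : E n × ℝ => (ρ z.2 * w₀ z.1 + timeMollify T ρ g z.1 z.2) *
      deriv (smoothAbs ε) (timeMollify T ρ w z.1 z.2)) (μ.prod τ) :=
    (j3.add j2).mul_bdd hSm hSb
  rw [← sub_le_iff_le_add', ← integral_sub (h.integrable_smoothAbs_slice hρ t₂ hε)
    (h.integrable_smoothAbs_slice hρ t₁ hε)]
  -- The chain rule and the fundamental theorem hold in t for almost every fixed x, because the
  -- mollification is smooth in time there; no derivative with values in a function space is needed.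
  have hFTC : ∫ x, (smoothAbs ε (timeMollify T ρ w x t₂) -
      smoothAbs ε (timeMollify T ρ w x t₁)) ∂μ =
      ∫ x, ∫ t, timeMollify T (deriv ρ) w x t *
        deriv (smoothAbs ε) (timeMollify T ρ w x t) ∂τ ∂μ := by
    refine integral_congr_ae ?_
    filter_upwards [hasDerivAt_timeMollify_ae T hρ.contDiff hρ.hasCompactSupport h.integrable,
      hasDerivAt_timeMollify_ae T hρ'.contDiff hρ'.hasCompactSupport h.integrable] with x hx hx'
    have c1 : Continuous (timeMollify T ρ w x) :=
      continuous_iff_continuousAt.2 fun t => (hx t).continuousAt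
    have c2 : Continuous (timeMollify T (deriv ρ) w x) :=
      continuous_iff_continuousAt.2 fun t => (hx' t).continuousAt
    have hd : ∀ t, HasDerivAt (fun t => smoothAbs ε (timeMollify T ρ w x t))
        (timeMollify T (deriv ρ) w x t * deriv (smoothAbs ε) (timeMollify T ρ w x t)) t := by
      intro t
      rw [mul_comm]
      exact ((contDiff_smoothAbs hε).differentiable (by simp) _).hasDerivAt.comp t (hx t)
    have hcont : Continuous (fun t => timeMollify T (deriv ρ) w x t *
        deriv (smoothAbs ε) (timeMollify T ρ w x t)) :=
      c2.mul ((contDiff_deriv_smoothAbs hε).continuous.comp c1)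
    rw [← intervalIntegral.integral_eq_sub_of_hasDerivAt (fun t _ => hd t)
      (hcont.intervalIntegrable _ _), intervalIntegral.integral_of_le h₁₂]
  rw [hFTC, integral_integral_swap k1, integral_prod_symm _ k2]
  refine integral_mono_ae k1.integral_prod_right k2.integral_prod_right ?_
  filter_upwards [ae_restrict_mem measurableSet_Ioc] with t ht
  exact h.integral_deriv_smoothAbs_le hν hρ (ht.2.trans h₂) hε

/-- The `L_1` bound for the mollified solution. -/
theorem integral_abs_timeMollify_le (h : IsHeatSolution Ω T ν w₀ w G g) (hν : 0 < ν) {ρ : ℝ → ℝ}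
    (hρ : IsTestFunction (Ioi 0) ρ) {t : ℝ} (h0 : 0 ≤ t) (ht : t ≤ T) :
    ∫ x in Ω, |timeMollify T ρ w x t| ≤
      (∫ r, |ρ r|) * (∫ x in Ω, |w₀ x|) +
      ∫ z, |timeMollify T ρ g z.1 z.2| ∂((volume.restrict Ω).prod (timeMeasure T)) := by
  set μ := volume.restrict Ω with hμ
  set τ := volume.restrict (Ioc 0 t) with hτ
  have hle : μ.prod τ ≤ μ.prod (timeMeasure T) := prod_restrict_Ioc_le μ le_rfl ht
  have J2 : Integrable (fun z : E n × ℝ => timeMollify T ρ g z.1 z.2) (μ.prod (timeMeasure T)) :=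
    integrable_timeMollify T hρ.contDiff.continuous hρ.hasCompactSupport
      h.stronglyMeasurable_rhs h.integrable_rhs
  have j2 := J2.mono_measure hle
  have hρi : Integrable ρ volume :=
    hρ.contDiff.continuous.integrable_of_hasCompactSupport hρ.hasCompactSupport
  have j3 : Integrable (fun z : E n × ℝ => w₀ z.1 * ρ z.2) (μ.prod τ) :=
    h.integrable_init.mul_prod hρi.integrableOn
  have i1 := integrable_timeMollify_slice T hρ.contDiff.continuous hρ.hasCompactSupport
    h.stronglyMeasurable h.integrable t
  -- The kernel only looks backward, so the mollified solution starts from zero; the initial value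
  -- w₀ enters instead as the source ρ(t)w₀.
  have hzero : ∀ x, timeMollify T ρ w x 0 = 0 := by
    intro x
    refine integral_eq_zero_of_ae ?_
    filter_upwards [ae_restrict_mem measurableSet_Ioo] with s hs
    have : ρ (0 - s) = 0 := image_eq_zero_of_notMem_tsupport fun hmem => by
      have := hρ.tsupport_subset hmem
      rw [mem_Ioi] at this
      linarith [hs.1]
    simp only [this, zero_smul, Pi.zero_apply]
  have hbound : ∀ ε > 0, ∫ x, |timeMollify T ρ w x t| ∂μ ≤
      ((∫ r, |ρ r|) * (∫ x, |w₀ x| ∂μ) +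
        ∫ z, |timeMollify T ρ g z.1 z.2| ∂(μ.prod (timeMeasure T))) + ε * μ.real univ := by
    intro ε hε
    have hS := h.integral_smoothAbs_le hν hρ le_rfl h0 ht hε
    simp only [hzero, smoothAbs_zero hε, integral_zero, zero_add] at hS
    have hP : ∫ z, (ρ z.2 * w₀ z.1 + timeMollify T ρ g z.1 z.2) *
        deriv (smoothAbs ε) (timeMollify T ρ w z.1 z.2) ∂(μ.prod τ) ≤
        ∫ z, (|w₀ z.1 * ρ z.2| + |timeMollify T ρ g z.1 z.2|) ∂(μ.prod τ) := by
      have j4 : Integrable (fun z : E n × ℝ => |w₀ z.1 * ρ z.2| + |timeMollify T ρ g z.1 z.2|)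
        (μ.prod τ) := j3.norm.add j2.norm
      refine (Real.le_norm_self _).trans
        (norm_integral_le_of_norm_le j4 (ae_of_all _ fun z => ?_))
      rw [norm_mul]
      refine (mul_le_of_le_one_right (norm_nonneg _) (abs_deriv_smoothAbs_le hε _)).trans ?_
      rw [mul_comm (ρ z.2)]
      exact norm_add_le _ _
    have hsplit : ∫ z, (|w₀ z.1 * ρ z.2| + |timeMollify T ρ g z.1 z.2|) ∂(μ.prod τ) =
        (∫ z, |w₀ z.1 * ρ z.2| ∂(μ.prod τ)) + ∫ z, |timeMollify T ρ g z.1 z.2| ∂(μ.prod τ) :=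
      integral_add j3.norm j2.norm
    have hA : ∫ z : E n × ℝ, |w₀ z.1 * ρ z.2| ∂(μ.prod τ) ≤
        (∫ r, |ρ r|) * (∫ x, |w₀ x| ∂μ) := by
      simp_rw [abs_mul]
      rw [integral_prod_mul (fun x => |w₀ x|) (fun s => |ρ s|), mul_comm]
      refine mul_le_mul_of_nonneg_right ?_ (integral_nonneg fun x => abs_nonneg _)
      exact setIntegral_le_integral hρi.norm (ae_of_all _ fun r => abs_nonneg _)
    have hB : ∫ z, |timeMollify T ρ g z.1 z.2| ∂(μ.prod τ) ≤
        ∫ z, |timeMollify T ρ g z.1 z.2| ∂(μ.prod (timeMeasure T)) :=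
      integral_mono_measure hle (ae_of_all _ fun z => abs_nonneg _) J2.norm
    have hC : ∫ x, |timeMollify T ρ w x t| ∂μ ≤
        ∫ x, (smoothAbs ε (timeMollify T ρ w x t) + ε) ∂μ :=
      integral_mono i1.norm ((h.integrable_smoothAbs_slice hρ t hε).add (integrable_const ε))
        fun x => abs_le_smoothAbs_add _
    rw [integral_add (h.integrable_smoothAbs_slice hρ t hε) (integrable_const ε),
      integral_const, smul_eq_mul, mul_comm (μ.real univ)] at hC
    linarith
  refine le_of_forall_pos_le_add fun δ hδ => ?_
  -- This ε makes the gap between |r| and its regularization cost at most δ over Ω.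
  have hb := hbound (δ / (μ.real univ + 1)) (by positivity)
  refine hb.trans (by
    gcongr
    rw [div_mul_eq_mul_div, div_le_iff₀ (by positivity)]
    nlinarith [measureReal_nonneg (μ := μ) (s := univ)])

end IsHeatSolution

theorem ae_ae_of_ae_prod_right {X Y : Type*} [MeasurableSpace X] [MeasurableSpace Y]
    {μ : Measure X} {τ : Measure Y} [SFinite μ] [SFinite τ] {p : X × Y → Prop}
    (h : ∀ᵐ z ∂(μ.prod τ), p z) : ∀ᵐ s ∂τ, ∀ᵐ x ∂μ, p (x, s) := by
  rw [← Measure.prod_swap] at h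
  exact Measure.ae_ae_of_ae_prod (ae_of_ae_map measurable_swap.aemeasurable h)

/-- The boundary term at s = T vanishes because ρ is zero on (-∞,0] and t ≤ T; the one at s = 0
gives ρ(t). Hence a function constant in time satisfies the weak formulation with itself as initial
value. -/
theorem integral_deriv_kernel_timeMeasure {T t : ℝ} (hT : 0 < T) (ht : t ≤ T) {ρ : ℝ → ℝ}
    (hρ : IsTestFunction (Ioi 0) ρ) : ∫ s, deriv ρ (t - s) ∂(timeMeasure T) = ρ t := by
  have hd : ∀ s, HasDerivAt (fun s => -ρ (t - s)) (deriv ρ (t - s)) s := fun s => by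
    have h1 := (hρ.contDiff.differentiable (by simp) (t - s)).hasDerivAt.comp_const_sub t s
    exact h1.fun_neg.congr_deriv (neg_neg _)
  have hc : Continuous (fun s => deriv ρ (t - s)) :=
    (isTestFunction_deriv hρ).contDiff.continuous.comp (by fun_prop)
  have h0 : ρ (t - T) = 0 := image_eq_zero_of_notMem_tsupport fun hmem => by
    have := hρ.tsupport_subset hmem
    rw [mem_Ioi] at this
    linarith
  rw [timeMeasure, Measure.restrict_congr_set (Ioo_ae_eq_Ioc (a := (0 : ℝ)) (b := T)),
    ← intervalIntegral.integral_of_le hT.le,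
    intervalIntegral.integral_eq_sub_of_hasDerivAt (fun s _ => hd s) (hc.intervalIntegrable _ _)]
  simp [h0]

namespace IsHeatSolution

variable [IsFiniteMeasure (volume.restrict Ω)] {T ν : ℝ} {w₀ : E n → ℝ} {w : E n × ℝ → ℝ}
  {G : E n × ℝ → E n} {g : E n × ℝ → ℝ}

/-- Subtracting a stationary test function from a solution. -/
theorem sub_isTestFunction (h : IsHeatSolution Ω T ν w₀ w G g) (hT : 0 < T) {φ : E n → ℝ}
    (hφ : IsTestFunction Ω φ) :
    ∃ g' : E n × ℝ → ℝ, IsHeatSolution Ω T ν (fun x => w₀ x - φ x) (fun z => w z - φ z.1)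
      (fun z => G z - gradient φ z.1) g' := by
  obtain ⟨q, hq, hqc, hlap⟩ := hφ.exists_laplacian
  set μ := volume.restrict Ω with hμ
  have hφc := hφ.contDiff.continuous
  have hgc := hφ.contDiff_gradient.continuous
  have hqi : Integrable q μ := (hq.memLp_of_hasCompactSupport (p := 1) hqc).integrable le_rfl
  have hφi : Integrable φ μ := (hφ.memLp 1).integrable le_rfl
  -- q is the Laplacian of φ, so the new source is g + νΔφ, still integrable.
  refine ⟨fun z => g z + ν * q z.1, ?_, ?_, ?_, ?_, ?_, ?_, ?_, ?_, ?_⟩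
  · exact h.stronglyMeasurable.sub (hφc.comp continuous_fst).stronglyMeasurable
  · exact h.stronglyMeasurable_grad.sub (hgc.comp continuous_fst).stronglyMeasurable
  · exact h.stronglyMeasurable_rhs.add
      ((hq.comp continuous_fst).const_mul ν).stronglyMeasurable
  · exact h.memLp.sub ((hφ.memLp 2).comp_fst _)
  · exact h.memLp_grad.sub ((hφ.memLp_gradient 2).comp_fst _)
  · exact h.integrable_rhs.add ((hqi.comp_fst _).const_mul ν)
  · exact h.integrable_init.sub hφi
  · filter_upwards [h.isTestLimit] with s hs
    exact hs.sub_isTestFunction hφ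
  · intro ρ hρ t ht ψ hψ
    have hρ' := isTestFunction_deriv hρ
    obtain ⟨C, hC⟩ := hψ.exists_bound
    obtain ⟨K, hK⟩ := exists_bound_of_hasCompactSupport hρ.contDiff.continuous
      hρ.hasCompactSupport
    obtain ⟨K', hK'⟩ := exists_bound_of_hasCompactSupport hρ'.contDiff.continuous
      hρ'.hasCompactSupport
    set π := μ.prod (timeMeasure T) with hπ
    have hψm : AEStronglyMeasurable (fun z : E n × ℝ => ψ z.1) π :=
      (hψ.contDiff.continuous.comp continuous_fst).aestronglyMeasurable
    have hψb : ∀ᵐ z : E n × ℝ ∂π, ‖ψ z.1‖ ≤ C := ae_of_all _ fun z => hC z.1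
    have hρm : AEStronglyMeasurable (fun z : E n × ℝ => ρ (t - z.2)) π :=
      (hρ.contDiff.continuous.comp (by fun_prop)).aestronglyMeasurable
    have hρb : ∀ᵐ z : E n × ℝ ∂π, ‖ρ (t - z.2)‖ ≤ K := ae_of_all _ fun z => hK _
    have hρm' : AEStronglyMeasurable (fun z : E n × ℝ => deriv ρ (t - z.2)) π :=
      (hρ'.contDiff.continuous.comp (by fun_prop)).aestronglyMeasurable
    have hρb' : ∀ᵐ z : E n × ℝ ∂π, ‖deriv ρ (t - z.2)‖ ≤ K' := ae_of_all _ fun z => hK' _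
    have a1 := (h.integrable.bdd_mul hψm hψb).bdd_mul hρm' hρb'
    have a2 := ((hφi.comp_fst (timeMeasure T)).bdd_mul hψm hψb).bdd_mul hρm' hρb'
    have b1 := (integrable_inner_of_memLp_two ((hψ.memLp_gradient (μ := μ) 2).comp_fst
      (timeMeasure T)) h.memLp_grad).bdd_mul hρm hρb
    have b2 := (integrable_inner_of_memLp_two ((hψ.memLp_gradient (μ := μ) 2).comp_fst
      (timeMeasure T)) ((hφ.memLp_gradient (μ := μ) 2).comp_fst
      (timeMeasure T))).bdd_mul hρm hρb
    have c1 := (h.integrable_rhs.bdd_mul hψm hψb).bdd_mul hρm hρb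
    have c2 := ((hqi.comp_fst (timeMeasure T)).bdd_mul hψm hψb).bdd_mul hρm hρb
    have hψm' : AEStronglyMeasurable ψ μ := hψ.contDiff.continuous.aestronglyMeasurable
    have d1 := h.integrable_init.mul_bdd hψm' (ae_of_all _ hC)
    have d2 := hφi.mul_bdd hψm' (ae_of_all _ hC)
    have e1 : ∫ z, deriv ρ (t - z.2) * (ψ z.1 * (w z - φ z.1)) ∂π =
        (∫ z, deriv ρ (t - z.2) * (ψ z.1 * w z) ∂π) -
          ∫ z : E n × ℝ, deriv ρ (t - z.2) * (ψ z.1 * φ z.1) ∂π := by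
      rw [← integral_sub a1 a2]
      exact integral_congr_ae (ae_of_all _ fun z => by ring)
    have e2 : ∫ z, ρ (t - z.2) * inner ℝ (gradient ψ z.1) (G z - gradient φ z.1) ∂π =
        (∫ z, ρ (t - z.2) * inner ℝ (gradient ψ z.1) (G z) ∂π) -
          ∫ z : E n × ℝ, ρ (t - z.2) * inner ℝ (gradient ψ z.1) (gradient φ z.1) ∂π := by
      rw [← integral_sub b1 b2]
      exact integral_congr_ae (ae_of_all _ fun z => by simp only [inner_sub_right]; ring)
    have e3 : ∫ z, ρ (t - z.2) * (ψ z.1 * (g z + ν * q z.1)) ∂π =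
        (∫ z, ρ (t - z.2) * (ψ z.1 * g z) ∂π) +
          ν * ∫ z : E n × ℝ, ρ (t - z.2) * (ψ z.1 * q z.1) ∂π := by
      rw [← integral_const_mul, ← integral_add c1 (c2.const_mul ν)]
      exact integral_congr_ae (ae_of_all _ fun z => by ring)
    have e4 : ∫ x, (w₀ x - φ x) * ψ x ∂μ = (∫ x, w₀ x * ψ x ∂μ) - ∫ x, φ x * ψ x ∂μ := by
      rw [← integral_sub d1 d2]
      exact integral_congr_ae (ae_of_all _ fun z => by ring)
    have hprod : ∀ (a : ℝ → ℝ) (c : E n → ℝ), ∫ z : E n × ℝ, a (t - z.2) * c z.1 ∂π =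
        (∫ s, a (t - s) ∂(timeMeasure T)) * ∫ x, c x ∂μ := by
      intro a c
      rw [mul_comm (∫ s, a (t - s) ∂(timeMeasure T)),
        ← integral_prod_mul c (fun s => a (t - s))]
      exact integral_congr_ae (ae_of_all _ fun z => mul_comm _ _)
    have f1 := hprod (deriv ρ) fun x => ψ x * φ x
    have f2 := hprod ρ fun x => inner ℝ (gradient ψ x) (gradient φ x)
    have f3 := hprod ρ fun x => ψ x * q x
    rw [integral_deriv_kernel_timeMeasure hT ht hρ] at f1
    have hl := hlap ψ hψ
    simp_rw [real_inner_comm (gradient ψ _) (gradient φ _)] at hl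
    have g1 : ∫ x, ψ x * φ x ∂μ = ∫ x, φ x * ψ x ∂μ := by simp_rw [mul_comm]
    have g3 : ∫ x, ψ x * q x ∂μ = ∫ x, q x * ψ x ∂μ := by simp_rw [mul_comm]
    have heq := h.weak_eq ρ hρ t ht ψ hψ
    rw [e1, e2, e3, e4, f1, f2, f3, hl, g1, g3]
    linear_combination heq

end IsHeatSolution

/-! ### Passage from the drift-diffusion equation to the heat equation. -/

/-- A weak solution of the drift-diffusion equation solves a heat equation with integrable
right-hand side. -/
theorem exists_isHeatSolution [IsFiniteMeasure (volume.restrict Ω)] {T ν : ℝ}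
    {b : E n × ℝ → E n} {u₀ : E n → ℝ} {f u : E n × ℝ → ℝ}
    {G : E n × ℝ → E n}
    (hb : MemLp b 2 (volume.restrict (cylinder Ω T))) (hu₀ : MemLp u₀ 2 (volume.restrict Ω))
    (hf : MemLp f 1 (volume.restrict (cylinder Ω T))) (hu : MemEnergyClass Ω T u G)
    (heq : ∀ η : E n × ℝ → ℝ, IsTestFunction (Ω ×ˢ Iio T) η →
      (∫ z in cylinder Ω T, (-(u z * derivT η z) + ν * inner ℝ (G z) (gradX η z))) +
          (∫ z in cylinder Ω T, inner ℝ (b z) (G z) * η z) =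
        (∫ x in Ω, u₀ x * η (x, 0)) + ∫ z in cylinder Ω T, f z * η z) :
    ∃ (u' : E n × ℝ → ℝ) (G' : E n × ℝ → E n) (g' : E n × ℝ → ℝ),
      u' =ᵐ[(volume.restrict Ω).prod (timeMeasure T)] u ∧
      G' =ᵐ[(volume.restrict Ω).prod (timeMeasure T)] G ∧
      g' =ᵐ[(volume.restrict Ω).prod (timeMeasure T)] (fun z => f z - inner ℝ (b z) (G z)) ∧
      IsHeatSolution Ω T ν u₀ u' G' g' := by
  set μ := volume.restrict Ω with hμ
  have hu2 := hu.memLp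
  have hG2 := hu.memLp_grad
  simp only [volume_restrict_cylinder] at hb hf hu2 hG2 heq
  rw [← hμ] at hb hf hu2 hG2
  set π := μ.prod (timeMeasure T) with hπ
  have hfi : Integrable f π := hf.integrable le_rfl
  have hbG : Integrable (fun z => inner ℝ (b z) (G z)) π := integrable_inner_of_memLp_two hb hG2
  have hgi : Integrable (fun z => f z - inner ℝ (b z) (G z)) π := hfi.sub hbG
  have hue := hu2.1.ae_eq_mk
  have hGe := hG2.1.ae_eq_mk
  have hge := hgi.1.ae_eq_mk
  -- Jointly strongly measurable representatives are used so that the mollified slices are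
  -- measurable at every time.
  refine ⟨hu2.1.mk u, hG2.1.mk G, hgi.1.mk _, hue.symm, hGe.symm, hge.symm, ?_⟩
  refine ⟨hu2.1.stronglyMeasurable_mk, hG2.1.stronglyMeasurable_mk, hgi.1.stronglyMeasurable_mk,
    hu2.ae_eq hue, hG2.ae_eq hGe, hgi.congr hge, hu₀.integrable (by simp), ?_, ?_⟩
  · have hsw : ∀ᵐ s ∂(timeMeasure T), ∀ᵐ x ∂μ,
        u (x, s) = hu2.1.mk u (x, s) ∧ G (x, s) = hG2.1.mk G (x, s) := by
      exact ae_ae_of_ae_prod_right (hue.and hGe)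
    filter_upwards [hu.memW12Zero, hsw] with s hs hs'
    exact IsTestLimit.congr hs.mem_closure (hs'.mono fun x hx => hx.1) (hs'.mono fun x hx => hx.2)
  · intro ρ hρ t ht ψ hψ
    have hρ' := isTestFunction_deriv hρ
    obtain ⟨C, hC⟩ := hψ.exists_bound
    obtain ⟨K, hK⟩ := exists_bound_of_hasCompactSupport hρ.contDiff.continuous
      hρ.hasCompactSupport
    obtain ⟨K', hK'⟩ := exists_bound_of_hasCompactSupport hρ'.contDiff.continuous
      hρ'.hasCompactSupport
    have hψm : AEStronglyMeasurable (fun z : E n × ℝ => ψ z.1) π :=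
      (hψ.contDiff.continuous.comp continuous_fst).aestronglyMeasurable
    have hψb : ∀ᵐ z : E n × ℝ ∂π, ‖ψ z.1‖ ≤ C := ae_of_all _ fun z => hC z.1
    have hρm : AEStronglyMeasurable (fun z : E n × ℝ => ρ (t - z.2)) π :=
      (hρ.contDiff.continuous.comp (by fun_prop)).aestronglyMeasurable
    have hρb : ∀ᵐ z : E n × ℝ ∂π, ‖ρ (t - z.2)‖ ≤ K := ae_of_all _ fun z => hK _
    have hρm' : AEStronglyMeasurable (fun z : E n × ℝ => deriv ρ (t - z.2)) π :=
      (hρ'.contDiff.continuous.comp (by fun_prop)).aestronglyMeasurable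
    have hρb' : ∀ᵐ z : E n × ℝ ∂π, ‖deriv ρ (t - z.2)‖ ≤ K' := ae_of_all _ fun z => hK' _
    have a1 := ((hu2.integrable (by simp)).bdd_mul hψm hψb).bdd_mul hρm' hρb'
    have b1 := (integrable_inner_of_memLp_two ((hψ.memLp_gradient (μ := μ) 2).comp_fst
      (timeMeasure T)) hG2).bdd_mul hρm hρb
    have c1 := (hfi.bdd_mul hψm hψb).bdd_mul hρm hρb
    have c2 := (hbG.bdd_mul hψm hψb).bdd_mul hρm hρb
    -- ρ is compactly supported in (0,∞) and t ≤ T, so s ↦ ρ(t - s) is supported in s < t, hence in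
    -- s < T. It need not vanish at s = 0, which produces the term ρ(t)∫u₀ψ.
    have htest : IsTestFunction (Ω ×ˢ Iio T) (kernelTest ρ t ψ) :=
      isTestFunction_kernelTest hρ (fun s hs => by
        rw [mem_Ioi] at hs
        rw [mem_Iio]
        linarith) hψ
    have hE := heq _ htest
    have e1 : ∫ z, (-(u z * derivT (kernelTest ρ t ψ) z) +
        ν * inner ℝ (G z) (gradX (kernelTest ρ t ψ) z)) ∂π =
        (∫ z, deriv ρ (t - z.2) * (ψ z.1 * u z) ∂π) +
          ν * ∫ z, ρ (t - z.2) * inner ℝ (gradient ψ z.1) (G z) ∂π := by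
      rw [← integral_const_mul, ← integral_add a1 (b1.const_mul ν)]
      refine integral_congr_ae (ae_of_all _ fun z => ?_)
      simp only
      rw [derivT_kernelTest (hρ.contDiff.differentiable (by simp)), gradX_kernelTest ρ t hψ,
        inner_smul_right, real_inner_comm]
      ring
    have e2 : ∫ x, u₀ x * kernelTest ρ t ψ (x, 0) ∂μ = ρ t * ∫ x, u₀ x * ψ x ∂μ := by
      rw [← integral_const_mul]
      refine integral_congr_ae (ae_of_all _ fun x => ?_)
      simp only [kernelTest, sub_zero]
      ring
    have e3 : (∫ z, f z * kernelTest ρ t ψ z ∂π) -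
        (∫ z, inner ℝ (b z) (G z) * kernelTest ρ t ψ z ∂π) =
        ∫ z, ρ (t - z.2) * (ψ z.1 * hgi.1.mk _ z) ∂π := by
      have h1 : ∫ z, f z * kernelTest ρ t ψ z ∂π = ∫ z, ρ (t - z.2) * (ψ z.1 * f z) ∂π :=
        integral_congr_ae (ae_of_all _ fun z => by simp only [kernelTest]; ring)
      have h2 : ∫ z, inner ℝ (b z) (G z) * kernelTest ρ t ψ z ∂π =
          ∫ z, ρ (t - z.2) * (ψ z.1 * inner ℝ (b z) (G z)) ∂π :=
        integral_congr_ae (ae_of_all _ fun z => by simp only [kernelTest]; ring)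
      rw [h1, h2, ← integral_sub c1 c2]
      refine integral_congr_ae ?_
      filter_upwards [hge] with z hz
      rw [← hz]
      ring
    have e4 : ∫ z, deriv ρ (t - z.2) * (ψ z.1 * hu2.1.mk u z) ∂π =
        ∫ z, deriv ρ (t - z.2) * (ψ z.1 * u z) ∂π := by
      refine integral_congr_ae ?_
      filter_upwards [hue] with z hz
      rw [← hz]
    have e5 : ∫ z, ρ (t - z.2) * inner ℝ (gradient ψ z.1) (hG2.1.mk G z) ∂π =
        ∫ z, ρ (t - z.2) * inner ℝ (gradient ψ z.1) (G z) ∂π := by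
      refine integral_congr_ae ?_
      filter_upwards [hGe] with z hz
      rw [← hz]
    rw [e1, e2] at hE
    rw [e4, e5, ← e3]
    linear_combination hE

/-! ### The continuous representative with values in L_1(Ω). -/

theorem dist_toL1_toL1 {X : Type*} [MeasurableSpace X] {μ : Measure X} {p q : X → ℝ}
    (hp : Integrable p μ) (hq : Integrable q μ) :
    dist (hp.toL1 p) (hq.toL1 q) = ∫ x, |p x - q x| ∂μ := by
  rw [dist_eq_norm, ← Integrable.toL1_sub, L1.norm_of_fun_eq_integral_norm]
  rfl

namespace IsHeatSolution

variable [IsFiniteMeasure (volume.restrict Ω)] {T ν : ℝ} {w₀ : E n → ℝ} {w : E n × ℝ → ℝ}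
  {G : E n × ℝ → E n} {g : E n × ℝ → ℝ}

theorem integrable_slice (h : IsHeatSolution Ω T ν w₀ w G g) (m : ℕ) (t : ℝ) :
    Integrable (fun x => timeMollify T (timeKernel m) w x t) (volume.restrict Ω) :=
  integrable_timeMollify_slice T (isTestFunction_timeKernel m).contDiff.continuous
    (isTestFunction_timeKernel m).hasCompactSupport h.stronglyMeasurable h.integrable t

/-- The mollified solution as a function of time with values in `L_1(Ω)`. -/
def slice (h : IsHeatSolution Ω T ν w₀ w G g) (m : ℕ) (t : ℝ) : Lp ℝ 1 (volume.restrict Ω) :=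
  (h.integrable_slice m t).toL1 _

/-- Moving from t to t' amounts to translating the kernel; the kernel is Lipschitz, so the slices
are Lipschitz in L_1 with constant proportional to ‖w‖₁. -/
theorem continuous_slice (h : IsHeatSolution Ω T ν w₀ w G g) (m : ℕ) :
    Continuous (h.slice m) := by
  have hρ := isTestFunction_timeKernel m
  obtain ⟨L, hL⟩ := ContDiff.lipschitzWith_of_hasCompactSupport hρ.hasCompactSupport
    hρ.contDiff (by simp)
  set I := ∫ z, ‖w z‖ ∂((volume.restrict Ω).prod (timeMeasure T)) with hI
  refine (LipschitzWith.of_dist_le_mul (K := L * I.toNNReal) fun t t' => ?_).continuous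
  rw [slice, slice, dist_toL1_toL1]
  have hc := hρ.contDiff.continuous
  have hc' : Continuous (fun r => timeKernel m (r + (t' - t))) := hc.comp (by fun_prop)
  have hs' : HasCompactSupport (fun r => timeKernel m (r + (t' - t))) :=
    hρ.hasCompactSupport.comp_homeomorph (Homeomorph.addRight (t' - t))
  have hker := timeMollify_kernel_sub_ae T hc hρ.hasCompactSupport hc' hs' h.integrable
  have hbd : ∀ r, ‖timeKernel m r - timeKernel m (r + (t' - t))‖ ≤ (L * nndist t t' : ℝ≥0) := by
    intro r
    have := hL.dist_le_mul r (r + (t' - t))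
    rw [Real.dist_eq, Real.dist_eq] at this
    rw [Real.norm_eq_abs, NNReal.coe_mul, coe_nndist, Real.dist_eq]
    refine this.trans_eq ?_
    congr 2
    ring
  have hle := integral_norm_timeMollify_slice_le (μ := volume.restrict Ω) T (hc.sub hc') hbd
    h.stronglyMeasurable h.integrable t
  calc ∫ x in Ω, |timeMollify T (timeKernel m) w x t - timeMollify T (timeKernel m) w x t'|
      = ∫ x in Ω, ‖timeMollify T (fun r => timeKernel m r - timeKernel m (r + (t' - t))) w x t‖ := by
        refine integral_congr_ae ?_
        filter_upwards [hker] with x hx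
        rw [hx t, Real.norm_eq_abs]
        congr 2
        simp only [timeMollify]
        congr 1
        ext s
        congr 2
        ring
    _ ≤ (L * nndist t t' : ℝ≥0) * I := hle
    _ = _ := by
        rw [NNReal.coe_mul, NNReal.coe_mul, coe_nndist, Real.coe_toNNReal I
          (integral_nonneg fun z => norm_nonneg _)]
        ring

/-- Uniform Cauchy estimate for the mollified solution after subtraction of a test function close
to the initial value. -/
theorem exists_uniform_cauchy (h : IsHeatSolution Ω T ν w₀ w G g) (hΩ : IsOpen Ω) (hT : 0 < T)
    (hν : 0 < ν) (hw₀ : MemLp w₀ 2 (volume.restrict Ω)) {δ : ℝ} (hδ : 0 < δ) :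
    ∃ (φ : E n → ℝ) (g' : E n × ℝ → ℝ) (h' : IsHeatSolution Ω T ν (fun x => w₀ x - φ x)
      (fun z => w z - φ z.1) (fun z => G z - gradient φ z.1) g') (N : ℕ),
      IsTestFunction Ω φ ∧ ∫ x in Ω, |w₀ x - φ x| ≤ δ ∧
      ∀ m ≥ N, ∀ l ≥ N, ∀ t ∈ Icc 0 T, dist (h'.slice m t) (h'.slice l t) ≤ δ := by
  -- The budget is 2·δ/4 for the initial term, since the kernel difference has L_1 norm at most 2,
  -- plus δ/4 for each of the two mollified sources.
  obtain ⟨φ, hφ, hφδ⟩ := exists_isTestFunction_integral_abs_sub_lt hΩ hw₀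
    (show 0 < δ / 4 by positivity)
  obtain ⟨g', h'⟩ := h.sub_isTestFunction hT hφ
  have hlim := tendsto_integral_norm_timeMollify_sub T h'.stronglyMeasurable_rhs h'.integrable_rhs
  obtain ⟨N, hN⟩ := eventually_atTop.1 (hlim.eventually_lt_const (show 0 < δ / 4 by positivity))
  refine ⟨φ, g', h', N, hφ, by linarith, fun m hm l hl t ht => ?_⟩
  have hρm := isTestFunction_timeKernel m
  have hρl := isTestFunction_timeKernel l
  have hcm := hρm.contDiff.continuous
  have hcl := hρl.contDiff.continuous
  have hρ := hρm.sub hρl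
  have hbound := h'.integral_abs_timeMollify_le hν hρ ht.1 ht.2
  set π := (volume.restrict Ω).prod (timeMeasure T) with hπ
  have e1 : ∫ x in Ω, |timeMollify T (fun r => timeKernel m r - timeKernel l r)
      (fun z => w z - φ z.1) x t| = dist (h'.slice m t) (h'.slice l t) := by
    rw [slice, slice, dist_toL1_toL1]
    refine integral_congr_ae ?_
    filter_upwards [timeMollify_kernel_sub_ae T hcm hρm.hasCompactSupport hcl
      hρl.hasCompactSupport h'.integrable] with x hx
    rw [hx t]
  have e2 : ∫ r, |timeKernel m r - timeKernel l r| ≤ 2 := by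
    have im : Integrable (timeKernel m) volume :=
      hcm.integrable_of_hasCompactSupport hρm.hasCompactSupport
    have il : Integrable (timeKernel l) volume :=
      hcl.integrable_of_hasCompactSupport hρl.hasCompactSupport
    calc ∫ r, |timeKernel m r - timeKernel l r| ≤ ∫ r, (‖timeKernel m r‖ + ‖timeKernel l r‖) :=
          integral_mono (im.sub il).norm (im.norm.add il.norm) fun r => norm_sub_le (timeKernel m r) _
      _ = 2 := by
          rw [integral_add im.norm il.norm, integral_norm_timeKernel, integral_norm_timeKernel]
          norm_num
  have jm := (integrable_timeMollify T hcm hρm.hasCompactSupport h'.stronglyMeasurable_rhs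
    h'.integrable_rhs).sub h'.integrable_rhs
  have jl := (integrable_timeMollify T hcl hρl.hasCompactSupport h'.stronglyMeasurable_rhs
    h'.integrable_rhs).sub h'.integrable_rhs
  have e3 : ∫ z, |timeMollify T (fun r => timeKernel m r - timeKernel l r) g' z.1 z.2| ∂π ≤
      (∫ z, ‖timeMollify T (timeKernel m) g' z.1 z.2 - g' z‖ ∂π) +
        ∫ z, ‖timeMollify T (timeKernel l) g' z.1 z.2 - g' z‖ ∂π := by
    have hadd := integral_add jm.norm jl.norm
    simp only [Pi.sub_apply] at hadd
    rw [← hadd]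
    refine integral_mono_ae (integrable_timeMollify T (hcm.sub hcl) hρ.hasCompactSupport
      h'.stronglyMeasurable_rhs h'.integrable_rhs).norm (jm.norm.add jl.norm) ?_
    filter_upwards [Measure.quasiMeasurePreserving_fst.ae (timeMollify_kernel_sub_ae T hcm
      hρm.hasCompactSupport hcl hρl.hasCompactSupport h'.integrable_rhs)] with z hz
    have hz2 := hz z.2
    rw [hz2]
    set a := timeMollify T (timeKernel m) g' z.1 z.2
    set c := timeMollify T (timeKernel l) g' z.1 z.2
    calc ‖a - c‖ = ‖(a - g' z) - (c - g' z)‖ := by congr 1; ring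
      _ ≤ _ := norm_sub_le _ _
  have hm' := hN m hm
  have hl' := hN l hl
  have h0 : 0 ≤ ∫ x in Ω, |w₀ x - φ x| := integral_nonneg fun x => abs_nonneg _
  have hprod : (∫ r, |timeKernel m r - timeKernel l r|) * (∫ x in Ω, |w₀ x - φ x|) ≤
      2 * (δ / 4) := mul_le_mul e2 hφδ.le h0 (by norm_num)
  rw [e1] at hbound
  linarith

/-- For positive times, subtracting a stationary function commutes with late mollifications. -/
theorem eventually_slice_sub (h : IsHeatSolution Ω T ν w₀ w G g) {φ : E n → ℝ}
    {g' : E n × ℝ → ℝ} (hφ : IsTestFunction Ω φ)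
    (h' : IsHeatSolution Ω T ν (fun x => w₀ x - φ x) (fun z => w z - φ z.1)
      (fun z => G z - gradient φ z.1) g') {t : ℝ} (ht : t ∈ Ioc 0 T) :
    ∀ᶠ m in atTop, h'.slice m t = h.slice m t - ((hφ.memLp 1).integrable le_rfl).toL1 φ := by
  filter_upwards [eventually_tsupport_timeKernel_subset ht.1] with m hm
  have hρ := isTestFunction_timeKernel m
  have hφi : Integrable φ (volume.restrict Ω) := (hφ.memLp 1).integrable le_rfl
  rw [slice, slice, ← Integrable.toL1_sub, Integrable.toL1_eq_toL1_iff]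
  filter_upwards [timeMollify_sub_ae T hρ.contDiff.continuous hρ.hasCompactSupport h.integrable
    (hφi.comp_fst (timeMeasure T))] with x hx
  rw [hx t, Pi.sub_apply]
  congr 1
  simp only [timeMollify, smul_eq_mul]
  rw [integral_mul_const, integral_kernel_timeMeasure ht.2 hm, integral_timeKernel, one_mul]

/-- The continuous representative in `L_1(Ω)` of a solution of the heat equation. -/
theorem exists_continuousOn_limit (h : IsHeatSolution Ω T ν w₀ w G g) (hΩ : IsOpen Ω)
    (hT : 0 < T) (hν : 0 < ν) (hw₀ : MemLp w₀ 2 (volume.restrict Ω)) :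
    ∃ v : ℝ → Lp ℝ 1 (volume.restrict Ω), ContinuousOn v (Icc 0 T) ∧
      v 0 = h.integrable_init.toL1 w₀ ∧
      ∀ t ∈ Ioc 0 T, Tendsto (fun m => h.slice m t) atTop (𝓝 (v t)) := by
  -- At fixed t > 0 the late slices of w and w - φ differ by the constant vector φ, which cancels in
  -- distances. How late depends on t, so uniformity in t is lost here; it is recovered below by
  -- working with w - φ.
  have hcauchy : ∀ t ∈ Ioc 0 T, CauchySeq (fun m => h.slice m t) := by
    intro t ht
    rw [Metric.cauchySeq_iff]
    intro ε hε
    obtain ⟨φ, g', h', N, hφ, -, hN⟩ := h.exists_uniform_cauchy hΩ hT hν hw₀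
      (show 0 < ε / 2 by positivity)
    obtain ⟨M, hM⟩ := eventually_atTop.1 (h.eventually_slice_sub hφ h' ht)
    refine ⟨max N M, fun m hm l hl => ?_⟩
    have hd := hN m (le_of_max_le_left hm) l (le_of_max_le_left hl) t ⟨ht.1.le, ht.2⟩
    rw [hM m (le_of_max_le_right hm), hM l (le_of_max_le_right hl), dist_sub_right] at hd
    linarith
  have hex : ∀ t, ∃ y : Lp ℝ 1 (volume.restrict Ω),
      t ∈ Ioc 0 T → Tendsto (fun m => h.slice m t) atTop (𝓝 y) := by
    intro t
    by_cases ht : t ∈ Ioc 0 T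
    · obtain ⟨y, hy⟩ := cauchySeq_tendsto_of_complete (hcauchy t ht)
      exact ⟨y, fun _ => hy⟩
    · exact ⟨0, fun h => absurd h ht⟩
  choose v' hv' using hex
  -- The value at 0 has to be prescribed: all mollifications vanish there.
  set v : ℝ → Lp ℝ 1 (volume.restrict Ω) :=
    fun t => if t = 0 then h.integrable_init.toL1 w₀ else v' t with hv
  have hv0 : v 0 = h.integrable_init.toL1 w₀ := by simp [hv]
  have hvt : ∀ t ∈ Ioc 0 T, Tendsto (fun m => h.slice m t) atTop (𝓝 (v t)) := by
    intro t ht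
    simp only [hv, if_neg ht.1.ne']
    exact hv' t ht
  refine ⟨v, ?_, hv0, hvt⟩
  refine continuousOn_of_uniform_approx_of_continuousOn fun u hu => ?_
  obtain ⟨ε, hε, hεu⟩ := Metric.mem_uniformity_dist.1 hu
  obtain ⟨φ, g', h', N, hφ, hφδ, hN⟩ := h.exists_uniform_cauchy hΩ hT hν hw₀
    (show 0 < ε / 2 by positivity)
  set Φ := ((hφ.memLp 1 (μ := volume.restrict Ω)).integrable le_rfl).toL1 φ with hΦ
  -- The approximants are the mollifications of w - φ, with φ added back unmollified. At t = 0 they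
  -- equal φ, which is close to w₀, so they are uniformly close to v up to and including the initial
  -- time.
  refine ⟨fun t => h'.slice N t + Φ, ((h'.continuous_slice N).add continuous_const).continuousOn,
    fun t ht => hεu ?_⟩
  refine lt_of_le_of_lt ?_ (half_lt_self hε)
  rcases eq_or_lt_of_le ht.1 with h0 | h0
  · subst h0
    have hz : h'.slice N 0 = 0 := by
      rw [slice, ← Integrable.toL1_zero, Integrable.toL1_eq_toL1_iff]
      · refine ae_of_all _ fun x => ?_
        refine integral_eq_zero_of_ae ?_
        filter_upwards [ae_restrict_mem measurableSet_Ioo] with s hs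
        have : timeKernel N (0 - s) = 0 := image_eq_zero_of_notMem_tsupport fun hmem => by
          have := (isTestFunction_timeKernel N).tsupport_subset hmem
          rw [mem_Ioi] at this
          linarith [hs.1]
        simp only [this, zero_smul, Pi.zero_apply]
      · exact integrable_zero _ _ _
    simp only
    rw [hz, zero_add, hv0, hΦ, dist_toL1_toL1]
    exact hφδ
  · have ht' : t ∈ Ioc 0 T := ⟨h0, ht.2⟩
    have hlim : Tendsto (fun m => dist (h'.slice m t + Φ) (h'.slice N t + Φ)) atTop
        (𝓝 (dist (v t) (h'.slice N t + Φ))) := by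
      refine Tendsto.dist ?_ tendsto_const_nhds
      refine (hvt t ht').congr' ?_
      filter_upwards [h.eventually_slice_sub hφ h' ht'] with m hm
      rw [hm, sub_add_cancel]
    refine le_of_tendsto hlim ?_
    filter_upwards [eventually_ge_atTop N] with m hm
    rw [dist_add_right]
    exact hN m hm N le_rfl t ht

/-- A sequence of mollifications converges almost everywhere. -/
theorem exists_seq_timeMollify_tendsto_ae (h : IsHeatSolution Ω T ν w₀ w G g) :
    ∃ ns : ℕ → ℕ, StrictMono ns ∧ ∀ᵐ z ∂((volume.restrict Ω).prod (timeMeasure T)),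
      Tendsto (fun k => timeMollify T (timeKernel (ns k)) w z.1 z.2) atTop (𝓝 (w z)) := by
  have hmi : ∀ m, Integrable (fun z : E n × ℝ => timeMollify T (timeKernel m) w z.1 z.2)
      ((volume.restrict Ω).prod (timeMeasure T)) := fun m =>
    integrable_timeMollify T (isTestFunction_timeKernel m).contDiff.continuous
      (isTestFunction_timeKernel m).hasCompactSupport h.stronglyMeasurable h.integrable
  have hlim := tendsto_integral_norm_timeMollify_sub T h.stronglyMeasurable h.integrable
  have hL1 := (ENNReal.continuous_ofReal.tendsto 0).comp hlim
  rw [ENNReal.ofReal_zero] at hL1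
  have hL1' : Tendsto (fun m => eLpNorm ((fun z : E n × ℝ => timeMollify T (timeKernel m) w
      z.1 z.2) - w) 1 ((volume.restrict Ω).prod (timeMeasure T))) atTop (𝓝 0) := by
    refine hL1.congr fun m => ?_
    rw [eLpNorm_one_eq_lintegral_enorm, Function.comp_apply]
    exact ofReal_integral_norm_eq_lintegral_enorm ((hmi m).sub h.integrable)
  have hmeas := tendstoInMeasure_of_tendsto_eLpNorm (p := 1) (by simp)
    (fun m => (hmi m).1) h.integrable.1 hL1'
  exact hmeas.exists_seq_tendsto_ae

/-- On almost every slice the mollifications converge in measure both to v(t) and, along a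
subsequence, to w(·,t); limits in measure are unique. -/
theorem ae_eq_of_tendsto_slice (h : IsHeatSolution Ω T ν w₀ w G g)
    {v : ℝ → Lp ℝ 1 (volume.restrict Ω)}
    (hv : ∀ t ∈ Ioc 0 T, Tendsto (fun m => h.slice m t) atTop (𝓝 (v t))) :
    ∀ᵐ t ∂(timeMeasure T), ∀ᵐ x ∂(volume.restrict Ω), v t x = w (x, t) := by
  obtain ⟨ns, hns, hae⟩ := h.exists_seq_timeMollify_tendsto_ae
  filter_upwards [ae_ae_of_ae_prod_right hae, ae_restrict_mem measurableSet_Ioo] with t ht htT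
  have h1 : TendstoInMeasure (volume.restrict Ω)
      (fun k x => timeMollify T (timeKernel (ns k)) w x t) atTop (fun x => w (x, t)) :=
    tendstoInMeasure_of_tendsto_ae (fun k => (h.integrable_slice (ns k) t).1) ht
  have h2 := (tendstoInMeasure_of_tendsto_Lp (hv t ⟨htT.1, htT.2.le⟩)).comp hns.tendsto_atTop
  have h3 : TendstoInMeasure (volume.restrict Ω)
      (fun k x => timeMollify T (timeKernel (ns k)) w x t) atTop (v t) :=
    h2.congr_left fun k => (h.integrable_slice (ns k) t).coeFn_toL1
  exact tendstoInMeasure_ae_unique h3 h1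

theorem tendsto_integral_smoothAbs_slice (h : IsHeatSolution Ω T ν w₀ w G g) {t : ℝ}
    {y : Lp ℝ 1 (volume.restrict Ω)} (hy : Tendsto (fun m => h.slice m t) atTop (𝓝 y))
    {ε : ℝ} (hε : 0 < ε) :
    Tendsto (fun m => ∫ x in Ω, smoothAbs ε (timeMollify T (timeKernel m) w x t)) atTop
      (𝓝 (∫ x in Ω, smoothAbs ε (y x))) := by
  have hyi : Integrable (fun x => smoothAbs ε (y x)) (volume.restrict Ω) :=
    integrable_smoothAbs_comp hε (L1.integrable_coeFn y)
  rw [tendsto_iff_dist_tendsto_zero] at hy ⊢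
  refine squeeze_zero (fun _ => dist_nonneg) (fun m => ?_) hy
  have hsi := h.integrable_smoothAbs_slice (isTestFunction_timeKernel m) t hε
  rw [Real.dist_eq, ← integral_sub hsi hyi, dist_eq_norm, L1.norm_eq_integral_norm,
    ← Real.norm_eq_abs]
  refine norm_integral_le_of_norm_le (L1.integrable_coeFn _).norm ?_
  filter_upwards [Lp.coeFn_sub (h.slice m t) y, (h.integrable_slice m t).coeFn_toL1] with x h1 h2
  rw [h1, Pi.sub_apply, slice, h2]
  exact abs_smoothAbs_sub_le hε _ _

/-! ### The limiting entropy inequality, the sign of the drift, and the L_1 estimate. -/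

/-- The entropy inequality for the continuous representative. -/
theorem integral_smoothAbs_limit_le (h : IsHeatSolution Ω T ν w₀ w G g) (hν : 0 < ν)
    {v : ℝ → Lp ℝ 1 (volume.restrict Ω)}
    (hv : ∀ t ∈ Ioc 0 T, Tendsto (fun m => h.slice m t) atTop (𝓝 (v t)))
    {t₁ t₂ : ℝ} (h₁ : 0 < t₁) (h₁₂ : t₁ ≤ t₂) (h₂ : t₂ ≤ T) {ε : ℝ} (hε : 0 < ε) :
    ∫ x in Ω, smoothAbs ε (v t₂ x) ≤ (∫ x in Ω, smoothAbs ε (v t₁ x)) +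
      ∫ z, g z * deriv (smoothAbs ε) (w z)
        ∂((volume.restrict Ω).prod (volume.restrict (Ioc t₁ t₂))) := by
  obtain ⟨ns, hns, hae⟩ := h.exists_seq_timeMollify_tendsto_ae
  set μ := volume.restrict Ω with hμ
  set π := μ.prod (volume.restrict (Ioc t₁ t₂)) with hπ
  have hle : π ≤ μ.prod (timeMeasure T) := prod_restrict_Ioc_le μ h₁.le h₂
  have hgi : Integrable g π := h.integrable_rhs.mono_measure hle
  set S' := deriv (smoothAbs ε) with hS'
  have hSc : Continuous S' := (contDiff_deriv_smoothAbs hε).continuous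
  have hSb : ∀ r, ‖S' r‖ ≤ 1 := abs_deriv_smoothAbs_le hε
  have hmi : ∀ m, Integrable (fun z : E n × ℝ => timeMollify T (timeKernel m) g z.1 z.2)
      (μ.prod (timeMeasure T)) := fun m =>
    integrable_timeMollify T (isTestFunction_timeKernel m).contDiff.continuous
      (isTestFunction_timeKernel m).hasCompactSupport h.stronglyMeasurable_rhs h.integrable_rhs
  have hSm : ∀ m, AEStronglyMeasurable
      (fun z : E n × ℝ => S' (timeMollify T (timeKernel m) w z.1 z.2)) π := fun m =>
    (hSc.comp_stronglyMeasurable (stronglyMeasurable_timeMollify T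
      (isTestFunction_timeKernel m).contDiff.continuous h.stronglyMeasurable)).aestronglyMeasurable
  have herr : Tendsto (fun k => ∫ z, ‖timeMollify T (timeKernel (ns k)) g z.1 z.2 - g z‖
      ∂(μ.prod (timeMeasure T))) atTop (𝓝 0) :=
    (tendsto_integral_norm_timeMollify_sub T h.stronglyMeasurable_rhs
      h.integrable_rhs).comp hns.tendsto_atTop
  -- Only S'(w_k) is passed to the limit here, by dominated convergence with majorant |g|; replacing
  -- the mollified source by g costs the L_1 error `herr`.
  have hmain : Tendsto (fun k => ∫ z, g z * S' (timeMollify T (timeKernel (ns k)) w z.1 z.2) ∂π)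
      atTop (𝓝 (∫ z, g z * S' (w z) ∂π)) := by
    refine tendsto_integral_of_dominated_convergence (fun z => ‖g z‖)
      (fun k => hgi.1.mul (hSm _)) hgi.norm (fun k => ae_of_all _ fun z => ?_) ?_
    · rw [norm_mul]
      exact mul_le_of_le_one_right (norm_nonneg _) (hSb _)
    · filter_upwards [ae_mono hle hae] with z hz
      exact ((hSc.tendsto _).comp hz).const_mul _
  have hL := (h.tendsto_integral_smoothAbs_slice (hv t₂ ⟨h₁.trans_le h₁₂, h₂⟩) hε).comp
    hns.tendsto_atTop
  have hR := (((h.tendsto_integral_smoothAbs_slice (hv t₁ ⟨h₁, h₁₂.trans h₂⟩) hε).comp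
    hns.tendsto_atTop).add hmain).add herr
  rw [add_zero] at hR
  refine le_of_tendsto_of_tendsto hL hR ?_
  -- For t₁ > 0 the kernel is eventually supported in (0,t₁), so the source ρ(t)w₀ vanishes
  -- throughout (t₁,t₂].
  filter_upwards [hns.tendsto_atTop.eventually (eventually_tsupport_timeKernel_subset h₁)]
    with k hk
  have hineq := h.integral_smoothAbs_le hν (isTestFunction_timeKernel (ns k)) h₁.le h₁₂ h₂ hε
  refine hineq.trans ?_
  simp only [Function.comp_apply]
  rw [add_assoc]
  refine add_le_add le_rfl ?_
  have hd : Integrable (fun z : E n × ℝ => timeMollify T (timeKernel (ns k)) g z.1 z.2 - g z)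
    (μ.prod (timeMeasure T)) := (hmi (ns k)).sub h.integrable_rhs
  have hd' := hd.mono_measure hle
  have hgS : Integrable (fun z => g z * S' (timeMollify T (timeKernel (ns k)) w z.1 z.2)) π :=
    hgi.mul_bdd (hSm _) (ae_of_all _ fun z => hSb _)
  have hdS := hd'.mul_bdd (hSm (ns k)) (ae_of_all _ fun z => hSb _)
  have hz2 : ∀ᵐ z ∂π, z.2 ∈ Ioc t₁ t₂ := by
    have : ∀ᵐ t ∂(volume.restrict (Ioc t₁ t₂)), t ∈ Ioc t₁ t₂ := ae_restrict_mem measurableSet_Ioc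
    exact Measure.quasiMeasurePreserving_snd.ae this
  calc ∫ z, (timeKernel (ns k) z.2 * w₀ z.1 + timeMollify T (timeKernel (ns k)) g z.1 z.2) *
        S' (timeMollify T (timeKernel (ns k)) w z.1 z.2) ∂π
      = ∫ z, (g z * S' (timeMollify T (timeKernel (ns k)) w z.1 z.2) +
          (timeMollify T (timeKernel (ns k)) g z.1 z.2 - g z) *
            S' (timeMollify T (timeKernel (ns k)) w z.1 z.2)) ∂π := by
        refine integral_congr_ae ?_
        filter_upwards [hz2] with z hz
        have : timeKernel (ns k) z.2 = 0 := image_eq_zero_of_notMem_tsupport fun hmem => by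
          linarith [(hk hmem).2, hz.1]
        rw [this]
        ring
    _ = (∫ z, g z * S' (timeMollify T (timeKernel (ns k)) w z.1 z.2) ∂π) +
          ∫ z, (timeMollify T (timeKernel (ns k)) g z.1 z.2 - g z) *
            S' (timeMollify T (timeKernel (ns k)) w z.1 z.2) ∂π := integral_add hgS hdS
    _ ≤ _ := by
        refine add_le_add le_rfl ?_
        refine (Real.le_norm_self _).trans ((norm_integral_le_of_norm_le hd'.norm
          (ae_of_all _ fun z => ?_)).trans (integral_mono_measure hle
            (ae_of_all _ fun z => norm_nonneg _) hd.norm))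
        rw [norm_mul]
        exact mul_le_of_le_one_right (norm_nonneg _) (hSb _)

end IsHeatSolution

theorem DivNonpos.congr {T : ℝ} {b b' : E n × ℝ → E n} (h : DivNonpos Ω T b)
    (hb : b =ᵐ[volume.restrict (cylinder Ω T)] b') : DivNonpos Ω T b' := by
  intro η hη hη0
  refine (h η hη hη0).trans_eq (integral_congr_ae ?_)
  filter_upwards [hb] with z hz
  rw [hz]

/-- The drift term has a sign when tested with the derivative of a smooth convex function. -/
theorem IsHeatSolution.integral_drift_nonneg [IsFiniteMeasure (volume.restrict Ω)] {T ν : ℝ}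
    {w₀ : E n → ℝ} {w : E n × ℝ → ℝ} {G b : E n × ℝ → E n} {g : E n × ℝ → ℝ}
    (h : IsHeatSolution Ω T ν w₀ w G g) (hdiv : DivNonpos Ω T b) (hbm : StronglyMeasurable b)
    (hb : MemLp b 2 ((volume.restrict Ω).prod (timeMeasure T))) {t₁ t₂ : ℝ} (h₁ : 0 ≤ t₁)
    (h₂ : t₂ ≤ T) {ε : ℝ} (hε : 0 < ε) :
    0 ≤ ∫ z, inner ℝ (b z) (G z) * deriv (smoothAbs ε) (w z)
      ∂((volume.restrict Ω).prod (volume.restrict (Ioc t₁ t₂))) := by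
  have hi : Integrable (fun z => inner ℝ (b z) (G z) * deriv (smoothAbs ε) (w z))
      ((volume.restrict Ω).prod (timeMeasure T)) :=
    (integrable_inner_of_memLp_two hb h.memLp_grad).mul_bdd (c := 1)
      ((contDiff_deriv_smoothAbs hε).continuous.comp_stronglyMeasurable
        h.stronglyMeasurable).aestronglyMeasurable
      (ae_of_all _ fun z => abs_deriv_smoothAbs_le hε _)
  rw [integral_prod_symm _ (hi.mono_measure (prod_restrict_Ioc_le _ h₁ h₂))]
  refine integral_nonneg_of_ae (ae_mono (restrict_Ioc_le_timeMeasure h₁ h₂) ?_)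
  filter_upwards [hdiv.ae_slice hbm hb, h.isTestLimit, memLp_two_slice_ae hb,
    memLp_two_slice_ae h.memLp, memLp_two_slice_ae h.memLp_grad] with s hs hlim hbs hws hGs
  exact hlim.integral_inner_deriv_smoothAbs_nonneg hws hGs hbs hs hε

/-- The `L_1` estimate between positive times. -/
theorem IsHeatSolution.norm_limit_le [IsFiniteMeasure (volume.restrict Ω)] {T ν : ℝ}
    {w₀ : E n → ℝ} {w : E n × ℝ → ℝ} {G b : E n × ℝ → E n} {g f : E n × ℝ → ℝ}
    (h : IsHeatSolution Ω T ν w₀ w G g) (hν : 0 < ν) (hdiv : DivNonpos Ω T b)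
    (hbm : StronglyMeasurable b) (hb : MemLp b 2 ((volume.restrict Ω).prod (timeMeasure T)))
    (hf : Integrable f ((volume.restrict Ω).prod (timeMeasure T)))
    (hg : ∀ᵐ z ∂((volume.restrict Ω).prod (timeMeasure T)), g z = f z - inner ℝ (b z) (G z))
    {v : ℝ → Lp ℝ 1 (volume.restrict Ω)}
    (hv : ∀ t ∈ Ioc 0 T, Tendsto (fun m => h.slice m t) atTop (𝓝 (v t)))
    {t₁ t₂ : ℝ} (h₁ : 0 < t₁) (h₁₂ : t₁ ≤ t₂) (h₂ : t₂ ≤ T) :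
    ‖v t₂‖ ≤ ‖v t₁‖ + ∫ t in t₁..t₂, ∫ x in Ω, |f (x, t)| := by
  set π := (volume.restrict Ω).prod (volume.restrict (Ioc t₁ t₂)) with hπ
  have hle : π ≤ (volume.restrict Ω).prod (timeMeasure T) := prod_restrict_Ioc_le _ h₁.le h₂
  have hfi : Integrable f π := hf.mono_measure hle
  have hfub : ∫ t in t₁..t₂, ∫ x, |f (x, t)| ∂(volume.restrict Ω) = ∫ z, |f z| ∂π := by
    rw [intervalIntegral.integral_of_le h₁₂]
    exact (integral_prod_symm _ hfi.norm).symm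
  have hbound : ∀ ε > 0, ‖v t₂‖ ≤ (‖v t₁‖ + ∫ z, |f z| ∂π) + ε * (volume.restrict Ω).real univ := by
    intro ε hε
    have hent := h.integral_smoothAbs_limit_le hν hv h₁ h₁₂ h₂ hε
    have hdrift := h.integral_drift_nonneg hdiv hbm hb h₁.le h₂ hε
    have hSm : AEStronglyMeasurable (fun z => deriv (smoothAbs ε) (w z)) π :=
      ((contDiff_deriv_smoothAbs hε).continuous.comp_stronglyMeasurable
        h.stronglyMeasurable).aestronglyMeasurable
    have hSb : ∀ᵐ z ∂π, ‖deriv (smoothAbs ε) (w z)‖ ≤ 1 :=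
      ae_of_all _ fun z => abs_deriv_smoothAbs_le hε _
    have hbG := (integrable_inner_of_memLp_two hb h.memLp_grad).mono_measure hle
    have hsplit : ∫ z, g z * deriv (smoothAbs ε) (w z) ∂π =
        (∫ z, f z * deriv (smoothAbs ε) (w z) ∂π) -
          ∫ z, inner ℝ (b z) (G z) * deriv (smoothAbs ε) (w z) ∂π := by
      rw [← integral_sub (hfi.mul_bdd hSm hSb) (hbG.mul_bdd hSm hSb)]
      refine integral_congr_ae ?_
      filter_upwards [ae_mono hle hg] with z hz
      rw [hz, sub_mul]
    have hfS : ∫ z, f z * deriv (smoothAbs ε) (w z) ∂π ≤ ∫ z, |f z| ∂π := by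
      refine (Real.le_norm_self _).trans (norm_integral_le_of_norm_le hfi.norm
        (ae_of_all _ fun z => ?_))
      rw [norm_mul]
      exact mul_le_of_le_one_right (norm_nonneg _) (abs_deriv_smoothAbs_le hε _)
    have hSi : ∀ y : Lp ℝ 1 (volume.restrict Ω),
        Integrable (fun x => smoothAbs ε (y x)) (volume.restrict Ω) := fun y =>
      integrable_smoothAbs_comp hε (L1.integrable_coeFn y)
    have hup : ∫ x, smoothAbs ε (v t₁ x) ∂(volume.restrict Ω) ≤ ‖v t₁‖ := by
      rw [L1.norm_eq_integral_norm]
      exact integral_mono (hSi _) (L1.integrable_coeFn _).norm fun x => smoothAbs_le_abs hε _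
    have hlow : ‖v t₂‖ ≤ (∫ x, smoothAbs ε (v t₂ x) ∂(volume.restrict Ω)) +
        ε * (volume.restrict Ω).real univ := by
      have : ∫ x, (smoothAbs ε (v t₂ x) + ε) ∂(volume.restrict Ω) =
          (∫ x, smoothAbs ε (v t₂ x) ∂(volume.restrict Ω)) + ε * (volume.restrict Ω).real univ := by
        rw [integral_add (hSi _) (integrable_const ε), integral_const, smul_eq_mul,
          mul_comm ((volume.restrict Ω).real univ)]
      rw [← this, L1.norm_eq_integral_norm]
      exact integral_mono (L1.integrable_coeFn _).norm ((hSi _).add (integrable_const ε))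
        fun x => abs_le_smoothAbs_add _
    linarith
  rw [hfub]
  refine le_of_forall_pos_le_add fun δ hδ => ?_
  refine (hbound (δ / ((volume.restrict Ω).real univ + 1)) (by positivity)).trans ?_
  gcongr
  rw [div_mul_eq_mul_div, div_le_iff₀ (by positivity)]
  nlinarith [measureReal_nonneg (μ := volume.restrict Ω) (s := univ)]

end ParabolicDrift

/-! ### Assembly, including the initial time. -/

open ParabolicDrift in
theorem mainTheorem1 {n : ℕ} (hn : 2 ≤ n) (Ω : Set (ParabolicDrift.E n))
    (hΩ : ParabolicDrift.IsBoundedLipschitzDomain Ω) (T ν : ℝ) (hT : 0 < T) (hν : 0 < ν)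
    (b : ParabolicDrift.E n × ℝ → ParabolicDrift.E n) (u₀ : ParabolicDrift.E n → ℝ)
    (f u : ParabolicDrift.E n × ℝ → ℝ)
    (hb : MemLp b 2 (volume.restrict (ParabolicDrift.cylinder Ω T)))
    (hu₀ : MemLp u₀ 2 (volume.restrict Ω))
    (hf : MemLp f 1 (volume.restrict (ParabolicDrift.cylinder Ω T)))
    (hdiv : ParabolicDrift.DivNonpos Ω T b)
    (hu : ParabolicDrift.IsWeakSolution Ω T ν b u₀ f u) :
    ∃ v : ℝ → Lp ℝ 1 (volume.restrict Ω),
      ContinuousOn v (Icc 0 T) ∧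
      (∀ᵐ t ∂(volume.restrict (Ioo (0 : ℝ) T)),
        ∀ᵐ x ∂(volume.restrict Ω), v t x = u (x, t)) ∧
      (∀ᵐ x ∂(volume.restrict Ω), v 0 x = u₀ x) ∧
      (∀ t₁ t₂ : ℝ, 0 ≤ t₁ → t₁ ≤ t₂ → t₂ ≤ T →
        ‖v t₂‖ ≤ ‖v t₁‖ + ∫ t in t₁..t₂, ∫ x in Ω, |f (x, t)|) ∧
      ((∀ᵐ z ∂(volume.restrict (ParabolicDrift.cylinder Ω T)), f z = 0) →
        AntitoneOn (fun t => ‖v t‖) (Icc 0 T)) := by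
  have hfin : IsFiniteMeasure (volume.restrict Ω) :=
    ⟨by simpa using hΩ.isBounded.measure_lt_top⟩
  obtain ⟨G, hE, heq⟩ := hu
  obtain ⟨u', G', g', hu', hG', hg', h⟩ := exists_isHeatSolution hb hu₀ hf hE heq
  obtain ⟨v, hvc, hv0, hvt⟩ := h.exists_continuousOn_limit hΩ.isOpen hT hν hu₀
  have hbe := hb.1.ae_eq_mk
  have hdiv' : DivNonpos Ω T (hb.1.mk b) := hdiv.congr hbe
  have hb' := hb.ae_eq hbe
  have hbm := hb.1.stronglyMeasurable_mk
  set b' := hb.1.mk b with hb'def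
  clear_value b'
  rw [volume_restrict_cylinder] at hb' hbe hf
  have hfi := hf.integrable le_rfl
  have hgb : ∀ᵐ z ∂((volume.restrict Ω).prod (timeMeasure T)),
      g' z = f z - inner ℝ (b' z) (G' z) := by
    filter_upwards [hg', hbe, hG'] with z h1 h2 h3
    rw [h1, ← h2, h3]
  have hpos : ∀ t₁ t₂ : ℝ, 0 < t₁ → t₁ ≤ t₂ → t₂ ≤ T →
      ‖v t₂‖ ≤ ‖v t₁‖ + ∫ t in t₁..t₂, ∫ x in Ω, |f (x, t)| := fun t₁ t₂ h₁ h₁₂ h₂ =>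
    h.norm_limit_le hν hdiv' hbm hb' hfi hgb hvt h₁ h₁₂ h₂
  have hinner : ∀ t₁ t₂ : ℝ, 0 ≤ t₁ → t₁ ≤ t₂ → t₂ ≤ T →
      IntervalIntegrable (fun t => ∫ x in Ω, |f (x, t)|) volume t₁ t₂ := by
    intro t₁ t₂ h₁ h₁₂ h₂
    rw [intervalIntegrable_iff_integrableOn_Ioc_of_le h₁₂]
    exact (hfi.norm.integral_prod_right).mono_measure (restrict_Ioc_le_timeMeasure h₁ h₂)
  have hest : ∀ t₁ t₂ : ℝ, 0 ≤ t₁ → t₁ ≤ t₂ → t₂ ≤ T →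
      ‖v t₂‖ ≤ ‖v t₁‖ + ∫ t in t₁..t₂, ∫ x in Ω, |f (x, t)| := by
    intro t₁ t₂ h₁ h₁₂ h₂
    rcases h₁.lt_or_eq with h0 | rfl
    · exact hpos t₁ t₂ h0 h₁₂ h₂
    rcases h₁₂.lt_or_eq with h0 | rfl
    -- For t₁ = 0, use the estimate from s > 0, enlarge the integral of |f| to start at 0, and let s
    -- → 0+ by continuity of v.
    · have hcont : Tendsto (fun s => ‖v s‖ + ∫ t in (0 : ℝ)..t₂, ∫ x in Ω, |f (x, t)|)
          (𝓝[>] 0) (𝓝 (‖v 0‖ + ∫ t in (0 : ℝ)..t₂, ∫ x in Ω, |f (x, t)|)) := by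
        have h1 : Tendsto v (𝓝[Icc 0 T] 0) (𝓝 (v 0)) := hvc 0 ⟨le_rfl, hT.le⟩
        have h2 : 𝓝[>] (0 : ℝ) ≤ 𝓝[Icc 0 T] 0 :=
          nhdsWithin_le_of_mem (mem_of_superset (Ioc_mem_nhdsGT hT) Ioc_subset_Icc_self)
        exact (h1.mono_left h2).norm.add_const _
      refine ge_of_tendsto hcont ?_
      filter_upwards [Ioc_mem_nhdsGT h0] with s hs
      refine (hpos s t₂ hs.1 hs.2 h₂).trans ?_
      have hadd := intervalIntegral.integral_add_adjacent_intervals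
        (hinner 0 s le_rfl hs.1.le (hs.2.trans h₂)) (hinner s t₂ hs.1.le hs.2 h₂)
      have hnn : 0 ≤ ∫ t in (0 : ℝ)..s, ∫ x in Ω, |f (x, t)| :=
        intervalIntegral.integral_nonneg hs.1.le fun t _ => integral_nonneg fun x => abs_nonneg _
      linarith
    · simp
  refine ⟨v, hvc, ?_, ?_, hest, ?_⟩
  · filter_upwards [h.ae_eq_of_tendsto_slice hvt, ae_ae_of_ae_prod_right hu'] with t h1 h2
    filter_upwards [h1, h2] with x h3 h4
    rw [h3, h4]
  · rw [hv0]
    exact h.integrable_init.coeFn_toL1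
  · intro hf0 t₁ ht₁ t₂ ht₂ h₁₂
    rw [volume_restrict_cylinder] at hf0
    have hle := hest t₁ t₂ ht₁.1 h₁₂ ht₂.2
    have hz : ∫ t in t₁..t₂, ∫ x in Ω, |f (x, t)| = 0 := by
      rw [intervalIntegral.integral_of_le h₁₂]
      refine integral_eq_zero_of_ae (ae_mono (restrict_Ioc_le_timeMeasure ht₁.1 ht₂.2) ?_)
      filter_upwards [ae_ae_of_ae_prod_right hf0] with t ht
      refine integral_eq_zero_of_ae ?_
      filter_upwards [ht] with x hx
      simp [hx]
    rw [hz, add_zero] at hle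
    exact hle

end
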